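/- Let $d\ge 1$ and $N\ge 0$ be integers. Let $M$ be a real $d\times d$ dilation matrix, i.e. all its (complex) eigenvalues are bigger than $1$ in modulus; put $m=|\det M|$, let $M^*$ be the transpose of $M$, and let $\|\cdot\|$ be the Euclidean operator norm. For $\phi:\mathbb R^d\to\mathbb C$, $j\in\mathbb Z$, $k\in\mathbb Z^d$ put $\phi_{jk}(x)=m^{j/2}\phi(M^jx+k)$. Fourier transforms are normalized by $\widehat g(\xi)=\int_{\mathbb R^d} g(x)e^{-2\pi i(x,\xi)}\,dx$ and are understood in the sense of tempered distributions. Let $$Lf=\sum_{[\beta]\le N}a_\beta D^\beta f,\qquad a_\beta\in\mathbb C,\ a_{\mathbf 0}\ne 0,$$ where $\beta\in\mathbb Z_+^d$, $[\beta]=\beta_1+\dots+\beta_d$. Suppose that (a) $\widetilde\phi=\sum_{[\beta]\le N}\overline{a_\beta}(-1)^{[\beta]}D^\beta\delta_{\mathbf 0}$ is the distribution associated with $L$, where $\delta_{\mathbf 0}$ is the Dirac delta at the origin; (b) $\phi\in\mathcal B$, i.e. $\phi(x)=\int_{\mathbb R^d}\theta(\xi)e^{2\pi i(x,\xi)}\,d\xi$,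 where $\theta:\mathbb R^d\to\mathbb C$ vanishes outside a (nondegenerate) parallelepiped $S=[a_1,b_1]\times\dots\times[a_d,b_d]$ and $\theta|_S\in C^d(S)$; (c) $\widetilde\phi$ and $\phi$ are strictly compatible with the number $\delta\in(0,\frac12)$, i.e. $\overline{\widehat\phi(\xi)}\,\widehat{\widetilde\phi}(\xi)=1$ for a.e. $\xi$ with $|\xi|<\delta$, and $\widehat\phi(\xi)=0$ for a.e. $\xi$ with $|l-\xi|<\delta$, for every $l\in\mathbb Z^d\setminus\{\mathbf 0\}$. Then there is a constant $C$ such that the following holds whenever $\varepsilon>0$ and (d) $f:\mathbb R^d\to\mathbb C$ is continuous, $\widehat f\in L_1(\mathbb R^d)$, and $\widehat f(\xi)=O(|\xi|^{-N-d-\varepsilon})$ as $|\xi|\to\infty$. The function $f$ is $N$ times continuously differentiable, $|\xi|^N|\widehat f(\xi)|$ is integrable, and for every $x\in\mathbb R^d$ and $j\in\mathbb Z$ the series $$\sum_{k\in\mathbb Z^d}Lf(M^{-j}\cdot)(-k)\,\phi_{jk}(x),$$ considered as the limit of the cubic partial sums over $\|k\|_\infty\le K$, $K\to\infty$, converges,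 and $$\Big|f(x)-m^{-j/2}\sum_{k\in\mathbb Z^d}Lf(M^{-j}\cdot)(-k)\,\phi_{jk}(x)\Big|\le C\,\|M^{*-j}\|^N\int_{|M^{*-j}\xi|\ge\delta}|\xi|^N|\widehat f(\xi)|\,d\xi .$$ Moreover, for every positive number $\vartheta$ that is smaller than the modulus of every eigenvalue of $M$ there is a constant $C'$ such that, for all integers $j\ge 0$, $$C\,\|M^{*-j}\|^N\int_{|M^{*-j}\xi|\ge\delta}|\xi|^N|\widehat f(\xi)|\,d\xi\le C'\,\vartheta^{-j(N+\varepsilon)}.$$ Here $C$ does not depend on $f$, $\varepsilon$, $j$ and $x$, and $C'$ does not depend on $j$ and $x$. -/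

import Mathlib

open MeasureTheory Filter Topology Set
open scoped SchwartzMap FourierTransform LineDeriv ComplexConjugate

namespace DiffExpansion

/-- The Euclidean space `ℝ^d`. -/
abbrev E (d : ℕ) : Type := EuclideanSpace ℝ (Fin d)

/-- An integer vector `k ∈ ℤ^d`, viewed as an element of `ℝ^d`. -/
def intVec {d : ℕ} (k : Fin d → ℤ) : E d := WithLp.toLp 2 (fun i => (k i : ℝ))

/-! ### Dilation matrices -/

/-- The complex eigenvalues of the real matrix `M`. -/
def eigenvalues {d : ℕ} (M : Matrix (Fin d) (Fin d) ℝ) : Set ℂ :=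
  spectrum ℂ (M.map (fun t : ℝ => (t : ℂ)))

/-- `M` is a dilation matrix: all its (complex) eigenvalues are bigger than `1` in modulus. -/
def IsDilation {d : ℕ} (M : Matrix (Fin d) (Fin d) ℝ) : Prop :=
  ∀ z ∈ eigenvalues M, 1 < ‖z‖

/-- The linear operator on `ℝ^d` given by a matrix. Its norm is the Euclidean operator norm. -/
noncomputable def op {d : ℕ} (A : Matrix (Fin d) (Fin d) ℝ) : E d →L[ℝ] E d :=
  Matrix.toEuclideanCLM (n := Fin d) (𝕜 := ℝ) A

/-- The operator `M^{*j}`, the `j`-th integer power of the transpose of `M`. -/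
noncomputable def adjPow {d : ℕ} (M : Matrix (Fin d) (Fin d) ℝ) (j : ℤ) : E d →L[ℝ] E d :=
  op (M.transpose ^ j)

/-- `φ_{jk}(x) = m^{j/2} φ(M^j x + k)`, where `m = |det M|`. -/
noncomputable def dilShift {d : ℕ} (M : Matrix (Fin d) (Fin d) ℝ) (φ : E d → ℂ)
    (j : ℤ) (k : Fin d → ℤ) (x : E d) : ℂ :=
  ((|M.det| ^ ((j : ℝ) / 2) : ℝ) : ℂ) * φ (op (M ^ j) x + intVec k)

/-! ### Partial derivatives and differential operators -/

/-- The `i`-th vector of the standard basis of `ℝ^d`. -/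
noncomputable def stdVec {d : ℕ} (i : Fin d) : E d := EuclideanSpace.single i (1 : ℝ)

/-- The multi-indices `β ∈ ℤ_+^d` with `[β] = β_1 + ⋯ + β_d ≤ N`. -/
def multiIndices (d N : ℕ) : Finset (Fin d → ℕ) :=
  (Fintype.piFinset fun _ => Finset.range (N + 1)).filter fun β => ∑ i, β i ≤ N

/-- `D^β f = ∂_1^{β_1} ⋯ ∂_d^{β_d} f` for functions `f` on `ℝ^d`. -/
noncomputable def funDeriv {d : ℕ} (β : Fin d → ℕ) (f : E d → ℂ) : E d → ℂ :=
  (List.finRange d).foldr (fun i g => (fun h x => lineDeriv ℝ h x (stdVec i))^[β i] g) f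

/-- `D^β T = ∂_1^{β_1} ⋯ ∂_d^{β_d} T` for tempered distributions `T` on `ℝ^d`. -/
noncomputable def distDeriv {d : ℕ} (β : Fin d → ℕ) (T : 𝓢'(E d, ℂ)) : 𝓢'(E d, ℂ) :=
  (List.finRange d).foldr (fun i U => (fun V : 𝓢'(E d, ℂ) => ∂_{stdVec i} V)^[β i] U) T

/-- The differential operator `L f = ∑_{[β] ≤ N} a_β D^β f`. -/
noncomputable def diffOp {d : ℕ} (N : ℕ) (a : (Fin d → ℕ) → ℂ) (f : E d → ℂ) : E d → ℂ :=
  fun x => ∑ β ∈ multiIndices d N, a β * funDeriv β f x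

/-- The distribution associated with `L = ∑_{[β] ≤ N} a_β D^β`, namely
`∑_{[β] ≤ N} conj(a_β) (-1)^{[β]} D^β δ`. -/
noncomputable def assocDist {d : ℕ} (N : ℕ) (a : (Fin d → ℕ) → ℂ) : 𝓢'(E d, ℂ) :=
  ∑ β ∈ multiIndices d N,
    (conj (a β) * (-1) ^ (∑ i, β i)) • distDeriv β (TemperedDistribution.delta (0 : E d))

/-! ### Fourier transforms of functions, in the sense of tempered distributions -/

/-- The tempered distribution `T` is (given by) the locally integrable function `f`:
`T ψ = ∫ ψ f` for every Schwartz function `ψ` such that `ψ f` is integrable, in particular for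
every compactly supported smooth `ψ`. -/
def IsGivenBy {d : ℕ} (T : 𝓢'(E d, ℂ)) (f : E d → ℂ) : Prop :=
  LocallyIntegrable f ∧
    ∀ ψ : 𝓢(E d, ℂ), Integrable (fun x => ψ x * f x) → T ψ = ∫ x, ψ x * f x

/-- `g` is the Fourier transform of the function `f`, in the sense of tempered distributions. -/
def IsFourierOf {d : ℕ} (g f : E d → ℂ) : Prop :=
  ∃ T : 𝓢'(E d, ℂ), IsGivenBy T f ∧ IsGivenBy (𝓕 T) g

/-! ### The class `𝓑` and strict compatibility -/

/-- The closed parallelepiped `[a_1, b_1] × ⋯ × [a_d, b_d]`. -/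
def box {d : ℕ} (a b : Fin d → ℝ) : Set (E d) := {ξ | ∀ i, ξ i ∈ Icc (a i) (b i)}

/-- The class `𝓑` of functions `φ(x) = ∫ θ(ξ) e^{2πi(x,ξ)} dξ`, where `θ` vanishes outside a
parallelepiped `S` and the restriction of `θ` to `S` is in `C^d(S)`. -/
def classB (d : ℕ) : Set (E d → ℂ) :=
  {φ | ∃ (a b : Fin d → ℝ) (θ : E d → ℂ), (∀ i, a i < b i) ∧
    (∀ ξ, ξ ∉ box a b → θ ξ = 0) ∧ ContDiffOn ℝ (d : ℕ) θ (box a b) ∧ φ = 𝓕⁻ θ}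

/-- `T` and `φ` are strictly compatible, with the number `δ`: the Fourier transforms of `T` and `φ`
are functions `u` and `v`, one has `conj(v) u = 1` a.e. on `{|ξ| < δ}`, and `v = 0` a.e. on
`{|l - ξ| < δ}` for every nonzero `l ∈ ℤ^d`. -/
def StrictlyCompatibleWith {d : ℕ} (δ : ℝ) (T : 𝓢'(E d, ℂ)) (φ : E d → ℂ) : Prop :=
  ∃ u v : E d → ℂ, IsGivenBy (𝓕 T) u ∧ IsFourierOf v φ ∧
    (∀ᵐ ξ : E d, ‖ξ‖ < δ → conj (v ξ) * u ξ = 1) ∧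
    ∀ l : Fin d → ℤ, l ≠ 0 → ∀ᵐ ξ : E d, ‖intVec l - ξ‖ < δ → v ξ = 0

/-! ### The expansion and the error bound -/

/-- The cubic partial sum `∑_{‖k‖_∞ ≤ K} L f(M^{-j} ·)(-k) φ_{jk}(x)`. -/
noncomputable def cubicSum {d : ℕ} (M : Matrix (Fin d) (Fin d) ℝ) (N : ℕ) (a : (Fin d → ℕ) → ℂ)
    (φ f : E d → ℂ) (j : ℤ) (x : E d) (K : ℕ) : ℂ :=
  ∑ k ∈ Fintype.piFinset (fun _ : Fin d => Finset.Icc (-(K : ℤ)) (K : ℤ)),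
    diffOp N a (fun y => f (op (M ^ (-j)) y)) (-intVec k) * dilShift M φ j k x

/-- `‖M^{*-j}‖^N ∫_{|M^{*-j} ξ| ≥ δ} |ξ|^N |g(ξ)| dξ`. -/
noncomputable def tailBound {d : ℕ} (M : Matrix (Fin d) (Fin d) ℝ) (N : ℕ) (δ : ℝ)
    (g : E d → ℂ) (j : ℤ) : ℝ :=
  ‖adjPow M (-j)‖ ^ N * ∫ ξ in {ξ : E d | δ ≤ ‖adjPow M (-j) ξ‖}, ‖ξ‖ ^ N * ‖g ξ‖

end DiffExpansion

/-! Put B = M^{*-j} and y = M^j x. By Fourier inversion f(x) is the integral of e^{2πi(Bη,y)} f̂(η),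
and applying L to f(M^{-j}·) multiplies f̂(η) by the symbol of L at Bη. The numbers φ(y + k) are
Fourier coefficients of the periodization P of θ(ξ)e^{2πi(ξ,y)}. Hence a normalized cubic partial
sum of the expansion is the integral of symbol(Bη) f̂(η) S_K(Bη), where S_K is the cubic partial
Fourier sum of P (`cubicSum_eq_integral`).

The crux is K → ∞, because θ may jump on the boundary of its box and the Fourier series of P need
not converge absolutely or uniformly. Two facts suffice. First, S_K is bounded uniformly in K: it
integrates a C^d function on a box against a product of Dirichlet kernels, whose primitives stay
bounded because the partial sums of ∑ sin(kx)/k do, so one integration by parts per variable works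
(`exists_norm_setIntegral_Icc_mul_prod_le`). Second, S_K → P in L² of the torus, so every
subsequence has a further one that converges a.e. Dominated convergence then puts P in place of S_K
(`tendsto_integral_mul_cubicFourierSum`).

The error is therefore the integral of (e^{2πi(Bη,y)} - symbol(Bη) P(Bη)) f̂(η). For |Bη| < δ only
the unshifted term of P survives and θ · symbol = 1, so the bracket vanishes; elsewhere it is
O(|Bη|^N), as P is bounded and the symbol has degree at most N (`exists_tendsto_cubicSum`). For the
rate, Gelfand's formula gives ‖B‖ ≤ cϑ^{-j}, so the remaining region lies in |η| ≥ (δ/c)ϑ^j, where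
the decay of f̂ gives O(ϑ^{-jε}) (`exists_tailBound_le`). -/

namespace DiffExpansion

/-! ### Bounded sine sums and the Dirichlet kernel. -/

lemma sq_sum_cos_add_sq_sum_sin (n : ℕ) (x : ℝ) :
    (∑ j ∈ Finset.range n, Real.cos (j * x)) ^ 2 + (∑ j ∈ Finset.range n, Real.sin (j * x)) ^ 2 =
      n + 2 * ∑ k ∈ Finset.range n, ((n : ℝ) - (k + 1)) * Real.cos ((k + 1) * x) := by
  induction n with
  | zero => simp
  | succ n ih =>
    -- The cross terms of the new summand with the old ones are cos((n - j)x); the reflection j ↦ n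
    -- - 1 - j orders them by frequency.
    have h1 : ∑ k ∈ Finset.range n, Real.cos (((k : ℝ) + 1) * x) =
        ∑ j ∈ Finset.range n, (Real.cos (n * x) * Real.cos (j * x) +
          Real.sin (n * x) * Real.sin (j * x)) := by
      rw [← Finset.sum_range_reflect]
      refine Finset.sum_congr rfl fun j hj => ?_
      rw [← Real.cos_sub]
      congr 1
      have : j + 1 ≤ n := Finset.mem_range.1 hj
      rw [Nat.sub_sub, Nat.cast_sub (by omega)]
      push_cast
      ring
    have h2 : ∑ k ∈ Finset.range (n + 1), (((n + 1 : ℕ) : ℝ) - (k + 1)) * Real.cos ((k + 1) * x) =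
        ∑ k ∈ Finset.range n, ((n : ℝ) - (k + 1)) * Real.cos ((k + 1) * x) +
          ∑ k ∈ Finset.range n, Real.cos (((k : ℝ) + 1) * x) := by
      rw [Finset.sum_range_succ, ← Finset.sum_add_distrib]
      simp only [Nat.cast_add, Nat.cast_one, sub_self, zero_mul, add_zero]
      refine Finset.sum_congr rfl fun k _ => by ring
    rw [h2, h1, Finset.sum_range_succ, Finset.sum_range_succ, Finset.sum_add_distrib,
      ← Finset.mul_sum, ← Finset.mul_sum]
    push_cast
    linear_combination ih + Real.sin_sq_add_cos_sq (n * x)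

/-- Fejér averaging: the sum with weights 1 - k/n, plus x/2, has derivative |∑ e^{ijx}|²/(2n) ≥ 0,
so it increases from 0 to π over the period. Removing the weights costs a mean of n sines, at most
1. -/
lemma abs_sum_sin_div_le_of_mem {n : ℕ} {x : ℝ} (hx : x ∈ Icc 0 (2 * Real.pi)) :
    |∑ k ∈ Finset.range n, Real.sin ((k + 1) * x) / (k + 1)| ≤ Real.pi + 1 := by
  rcases Nat.eq_zero_or_pos n with rfl | hn
  · simpa using by positivity
  have hn' : (0 : ℝ) < n := by exact_mod_cast hn
  set g : ℝ → ℝ := fun x => ∑ k ∈ Finset.range n,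
    (1 - ((k : ℝ) + 1) / n) * (Real.sin ((k + 1) * x) / (k + 1)) + x / 2 with hg
  have hder : ∀ x, HasDerivAt g (∑ k ∈ Finset.range n,
      (1 - ((k : ℝ) + 1) / n) * Real.cos ((k + 1) * x) + 1 / 2) x := by
    intro x
    refine HasDerivAt.add (HasDerivAt.fun_sum fun k _ => ?_) ((hasDerivAt_id x).div_const 2)
    refine HasDerivAt.const_mul _ ?_
    have := (((hasDerivAt_id x).const_mul ((k : ℝ) + 1)).sin).div_const ((k : ℝ) + 1)
    refine this.congr_deriv ?_
    have : (k : ℝ) + 1 ≠ 0 := by positivity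
    simp only [id]
    field_simp
  have hmono : Monotone g := by
    refine monotone_of_deriv_nonneg (fun x => (hder x).differentiableAt) fun x => ?_
    rw [(hder x).deriv]
    have := sq_sum_cos_add_sq_sum_sin n x
    have h3 : ∑ k ∈ Finset.range n, (1 - ((k : ℝ) + 1) / n) * Real.cos ((k + 1) * x) =
        (∑ k ∈ Finset.range n, ((n : ℝ) - (k + 1)) * Real.cos ((k + 1) * x)) / n := by
      rw [Finset.sum_div]
      refine Finset.sum_congr rfl fun k _ => ?_
      field_simp
    rw [h3]
    have h4 : 0 ≤ (n : ℝ) +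
        2 * ∑ k ∈ Finset.range n, ((n : ℝ) - (k + 1)) * Real.cos ((k + 1) * x) := by
      rw [← this]; positivity
    rw [div_add_div _ _ hn'.ne' two_ne_zero]
    apply div_nonneg <;> linarith
  have g0 : g 0 = 0 := by simp [hg]
  have g1 : g (2 * Real.pi) = Real.pi := by
    have : ∀ k : ℕ, Real.sin (((k : ℝ) + 1) * (2 * Real.pi)) = 0 := fun k => by
      have := Real.sin_nat_mul_pi (2 * (k + 1))
      push_cast at this
      rw [← this]; ring_nf
    simp [hg, this]
  have h0 := hmono hx.1
  have h1 := hmono hx.2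
  rw [g0] at h0
  rw [g1] at h1
  have hS : ∑ k ∈ Finset.range n, Real.sin ((k + 1) * x) / (k + 1) =
      g x - x / 2 + (∑ k ∈ Finset.range n, Real.sin ((k + 1) * x)) / n := by
    simp only [hg, add_sub_cancel_right]
    rw [Finset.sum_div, ← Finset.sum_add_distrib]
    refine Finset.sum_congr rfl fun k _ => ?_
    have : (k : ℝ) + 1 ≠ 0 := by positivity
    field_simp
    ring
  have hb : |(∑ k ∈ Finset.range n, Real.sin ((k + 1) * x)) / n| ≤ 1 := by
    rw [abs_div, abs_of_pos hn', div_le_one hn']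
    refine (Finset.abs_sum_le_sum_abs _ _).trans ?_
    refine (Finset.sum_le_sum fun k _ => Real.abs_sin_le_one _).trans ?_
    simp
  rw [hS]
  have hp := Real.pi_pos
  have hb' := abs_le.1 hb
  obtain ⟨hx1, hx2⟩ := hx
  rw [abs_le]
  constructor <;> linarith

/-- The partial sums of `∑ sin (k x) / k` are uniformly bounded. -/
lemma abs_sum_sin_div_le (n : ℕ) (x : ℝ) :
    |∑ k ∈ Finset.range n, Real.sin ((k + 1) * x) / (k + 1)| ≤ Real.pi + 1 := by
  have hp : (0 : ℝ) < 2 * Real.pi := by positivity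
  obtain ⟨hy, z, hz⟩ : toIcoMod hp 0 x ∈ Ico 0 (0 + 2 * Real.pi) ∧
      ∃ z : ℤ, x = toIcoMod hp 0 x + z * (2 * Real.pi) :=
    ⟨toIcoMod_mem_Ico hp 0 x, toIcoDiv hp 0 x, by
      have := toIcoMod_add_toIcoDiv_zsmul hp 0 x
      rw [zsmul_eq_mul] at this; exact this.symm⟩
  rw [zero_add] at hy
  have := abs_sum_sin_div_le_of_mem (n := n) (Ico_subset_Icc_self hy)
  have hs : ∀ k : ℕ, Real.sin ((k + 1) * x) = Real.sin ((k + 1) * toIcoMod hp 0 x) := fun k => by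
    rw [← Real.sin_add_int_mul_two_pi ((k + 1) * toIcoMod hp 0 x) ((k + 1) * z)]
    conv_lhs => rw [hz]
    push_cast
    ring_nf
  simpa only [hs] using this

/-- The Dirichlet kernel with frequencies in `[-K, K]`. -/
noncomputable def dirichlet (K : ℕ) (t : ℝ) : ℂ :=
  ∑ k ∈ Finset.Icc (-(K : ℤ)) K, Complex.exp (2 * Real.pi * Complex.I * (k * t))

lemma dirichlet_eq (K : ℕ) (t : ℝ) :
    dirichlet K t =
      ((1 + 2 * ∑ k ∈ Finset.range K, Real.cos (2 * Real.pi * (k + 1) * t) : ℝ) : ℂ) := by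
  induction K with
  | zero => simp [dirichlet]
  | succ K ih =>
    have : Finset.Icc (-((K + 1 : ℕ) : ℤ)) ((K + 1 : ℕ) : ℤ) =
        insert (-((K + 1 : ℕ) : ℤ)) (insert (((K + 1 : ℕ) : ℤ)) (Finset.Icc (-(K : ℤ)) K)) := by
      ext z; simp only [Finset.mem_insert, Finset.mem_Icc]; omega
    rw [dirichlet, this, Finset.sum_insert, Finset.sum_insert, ← dirichlet, ih,
      Finset.sum_range_succ]
    · push_cast
      rw [mul_add, Complex.two_cos]
      ring_nf
    · simp
    · simp only [Finset.mem_insert, Finset.mem_Icc]; omega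

/-- A primitive of the Dirichlet kernel. -/
noncomputable def dirichletPrimitive (K : ℕ) (t : ℝ) : ℝ :=
  t + (∑ k ∈ Finset.range K, Real.sin ((k + 1) * (2 * Real.pi * t)) / (k + 1)) / Real.pi

lemma hasDerivAt_dirichletPrimitive (K : ℕ) (t : ℝ) :
    HasDerivAt (fun t => (dirichletPrimitive K t : ℂ)) (dirichlet K t) t := by
  rw [dirichlet_eq]
  refine HasDerivAt.ofReal_comp ?_
  refine HasDerivAt.add (hasDerivAt_id t) ?_
  rw [Finset.mul_sum]
  simp only [Finset.sum_div]
  refine HasDerivAt.fun_sum fun k _ => ?_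
  have := ((((hasDerivAt_id t).const_mul (2 * Real.pi)).const_mul ((k : ℝ) + 1)).sin.div_const
    ((k : ℝ) + 1)).div_const Real.pi
  refine this.congr_deriv ?_
  have : (k : ℝ) + 1 ≠ 0 := by positivity
  simp only [id]
  field_simp

lemma abs_dirichletPrimitive_sub_le (K : ℕ) (t : ℝ) : |dirichletPrimitive K t - t| ≤ 2 := by
  rw [dirichletPrimitive, add_sub_cancel_left, abs_div, abs_of_pos Real.pi_pos,
    div_le_iff₀ Real.pi_pos]
  have := abs_sum_sin_div_le K (2 * Real.pi * t)
  have := Real.pi_gt_three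
  linarith

lemma contDiff_dirichlet (K : ℕ) : ContDiff ℝ 1 (dirichlet K) := by
  unfold dirichlet
  refine ContDiff.sum fun k _ => ?_
  refine ContDiff.cexp (contDiff_const.mul (contDiff_const.mul ?_))
  exact Complex.ofRealCLM.contDiff

/-! ### Integration by parts on boxes against Dirichlet kernels. -/

variable {d : ℕ}

/-- Divergence theorem for the field whose only nonzero component is F in direction i: the two faces
that could contribute are those where F vanishes. -/
lemma setIntegral_Icc_fderiv_apply_eq_zero {a b : Fin d → ℝ} (hab : a ≤ b) (i : Fin d)
    {F : (Fin d → ℝ) → ℂ} {F' : (Fin d → ℝ) → (Fin d → ℝ) →L[ℝ] ℂ}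
    (Hc : ContinuousOn F (Icc a b))
    (Hd : ∀ x ∈ pi univ fun i => Ioo (a i) (b i), HasFDerivAt F (F' x) x)
    (Hi : IntegrableOn (fun x => F' x (Pi.single i 1)) (Icc a b))
    (h0 : ∀ x, x i = a i ∨ x i = b i → F x = 0) :
    ∫ x in Icc a b, F' x (Pi.single i 1) = 0 := by
  obtain _ | n := d
  · exact i.elim0
  have key : ∀ x, ∑ j, (if j = i then F' x else 0) (Pi.single j 1) = F' x (Pi.single i 1) := by
    intro x
    rw [Finset.sum_eq_single i]
    · simp
    · intro j _ hj; simp [hj]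
    · simp
  have := integral_divergence_of_hasFDerivAt_off_countable' a b hab
    (fun j => if j = i then F else 0) (fun j x => if j = i then F' x else 0) ∅ countable_empty
    (fun j => by
      by_cases hj : j = i
      · simpa [hj] using Hc
      · simp only [hj, if_false]; exact continuousOn_const)
    (fun x hx j => by
      by_cases hj : j = i
      · simpa [hj] using Hd x hx.1
      · simp only [hj, if_false]; exact hasFDerivAt_const (0 : ℂ) x)
    (by simpa only [key] using Hi)
  simp only [key] at this
  rw [this]
  refine Finset.sum_eq_zero fun j _ => ?_
  by_cases hj : j = i
  · subst hj
    simp [h0]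
  · simp [hj]

/-- `q` differs from a constant by the derivative of a function that vanishes at both end points
of `[a, b]`; the constant and the function are bounded by `B`. -/
def HasBoundedPrimitive (B a b : ℝ) (q : ℝ → ℂ) : Prop :=
  ∃ (c : ℂ) (W : ℝ → ℂ), ‖c‖ ≤ B ∧ ContDiff ℝ 1 W ∧ (∀ t ∈ Icc a b, ‖W t‖ ≤ B) ∧
    W a = 0 ∧ W b = 0 ∧ ∀ t, q t = c - deriv W t

lemma continuousOn_mul_prod {a b : Fin d → ℝ} {h : (Fin d → ℝ) → ℂ} {q : Fin d → ℝ → ℂ}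
    (hh : ContinuousOn h (Icc a b)) (hq : ∀ j, Continuous (q j)) :
    ContinuousOn (fun x => h x * ∏ j, q j (x j)) (Icc a b) :=
  hh.mul (Continuous.continuousOn (by fun_prop))

/-- Integration by parts in the i-th variable. There is no boundary term because W vanishes at both
end points; what remains is the constant c with the factor removed, and a derivative of h with W as
the factor. -/
lemma setIntegral_Icc_mul_prod_eq {a b : Fin d → ℝ} (hab : ∀ i, a i < b i) (i : Fin d)
    {h : (Fin d → ℝ) → ℂ} (hh : ContDiffOn ℝ 1 h (Icc a b)) {q : Fin d → ℝ → ℂ}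
    (hq : ∀ j, ContDiff ℝ 1 (q j)) {c : ℂ} {W : ℝ → ℂ} (hW : ContDiff ℝ 1 W)
    (hWa : W (a i) = 0) (hWb : W (b i) = 0) (hqW : ∀ t, q i t = c - deriv W t) :
    ∫ x in Icc a b, h x * ∏ j, q j (x j) =
      c * (∫ x in Icc a b, h x * ∏ j, Function.update q i 1 j (x j)) +
        ∫ x in Icc a b, fderivWithin ℝ h (Icc a b) x (Pi.single i 1) *
          ∏ j, Function.update q i W j (x j) := by
  have hle : a ≤ b := fun i => (hab i).le
  have hint : interior (Icc a b) = pi univ fun i => Ioo (a i) (b i) := by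
    rw [← pi_univ_Icc, interior_pi_set finite_univ]; simp
  have hud : UniqueDiffOn ℝ (Icc a b) := by
    refine uniqueDiffOn_convex (convex_Icc a b) ?_
    rw [hint, univ_pi_nonempty_iff]
    exact fun i => nonempty_Ioo.2 (hab i)
  have hh' : ContinuousOn (fun x => fderivWithin ℝ h (Icc a b) x (Pi.single i 1)) (Icc a b) :=
    (hh.continuousOn_fderivWithin hud le_rfl).clm_apply continuousOn_const
  set r : Fin d → ℝ → ℂ := Function.update q i W with hr
  have hri : r i = W := by simp [hr]
  have hrC : ∀ j, ContDiff ℝ 1 (r j) := by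
    intro j
    by_cases hj : j = i
    · subst hj; rwa [hri]
    · rw [hr, Function.update_of_ne hj]; exact hq j
  have hprod : ∀ (p : ℝ → ℂ) (x : Fin d → ℝ), ∏ j, Function.update q i p j (x j) =
      p (x i) * ∏ j ∈ Finset.univ.erase i, q j (x j) := by
    intro p x
    rw [← Finset.mul_prod_erase _ _ (Finset.mem_univ i), Function.update_self]
    congr 1
    refine Finset.prod_congr rfl fun j hj => ?_
    rw [Function.update_of_ne (Finset.ne_of_mem_erase hj)]
  have hprod0 : ∀ (x : Fin d → ℝ), ∏ j, q j (x j) =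
      q i (x i) * ∏ j ∈ Finset.univ.erase i, q j (x j) := by
    intro x
    rw [← Finset.mul_prod_erase _ _ (Finset.mem_univ i)]
  set F' : (Fin d → ℝ) → (Fin d → ℝ) →L[ℝ] ℂ := fun x =>
    h x • (∑ j, (∏ l ∈ Finset.univ.erase j, r l (x l)) •
      ((ContinuousLinearMap.proj j : (Fin d → ℝ) →L[ℝ] ℝ).smulRight (deriv (r j) (x j)))) +
    (∏ j, r j (x j)) • fderivWithin ℝ h (Icc a b) x with hF'
  have hF'i : ∀ x, F' x (Pi.single i 1) =
      h x * ∏ j, Function.update q i (deriv W) j (x j) +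
        fderivWithin ℝ h (Icc a b) x (Pi.single i 1) * ∏ j, r j (x j) := by
    intro x
    simp only [hF', add_apply, smul_apply,
      sum_apply, ContinuousLinearMap.smulRight_apply,
      ContinuousLinearMap.proj_apply, smul_eq_mul]
    rw [mul_comm (∏ j, r j (x j))]
    congr 2
    rw [Finset.sum_eq_single i, hri, hprod]
    · rw [Pi.single_eq_same, one_smul, mul_comm]
      congr 1
      refine Finset.prod_congr rfl fun j hj => ?_
      rw [hr, Function.update_of_ne (Finset.ne_of_mem_erase hj)]
    · intro j _ hj
      rw [Pi.single_eq_of_ne hj, zero_smul, mul_zero]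
    · simp
  have hcW : Continuous (deriv W) := hW.continuous_deriv le_rfl
  have hup : ∀ p : ℝ → ℂ, Continuous p → ∀ j, Continuous (Function.update q i p j) := by
    intro p hp j
    by_cases hj : j = i
    · subst hj; simpa using hp
    · rw [Function.update_of_ne hj]; exact (hq j).continuous
  have I1 : IntegrableOn (fun x => h x * ∏ j, Function.update q i (deriv W) j (x j)) (Icc a b) :=
    (continuousOn_mul_prod hh.continuousOn (hup _ hcW)).integrableOn_compact isCompact_Icc
  have I2 : IntegrableOn (fun x => fderivWithin ℝ h (Icc a b) x (Pi.single i 1) *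
      ∏ j, r j (x j)) (Icc a b) :=
    (continuousOn_mul_prod hh' (hup _ hW.continuous)).integrableOn_compact isCompact_Icc
  have I3 : IntegrableOn (fun x => h x * ∏ j, Function.update q i 1 j (x j)) (Icc a b) :=
    (continuousOn_mul_prod hh.continuousOn (hup _ continuous_one)).integrableOn_compact
      isCompact_Icc
  have hzero := setIntegral_Icc_fderiv_apply_eq_zero hle i
    (F := fun x => h x * ∏ j, r j (x j)) (F' := F')
    (continuousOn_mul_prod hh.continuousOn fun j => (hrC j).continuous)
    (fun x hx => by
      have hx' : Icc a b ∈ 𝓝 x := by rw [mem_interior_iff_mem_nhds.symm, hint]; exact hx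
      have h1 : HasFDerivAt h (fderivWithin ℝ h (Icc a b) x) x :=
        ((hh.differentiableOn one_ne_zero) x (mem_of_mem_nhds hx')).hasFDerivWithinAt.hasFDerivAt
          hx'
      refine h1.mul (HasFDerivAt.finsetProd fun j _ => ?_)
      have h2 : HasDerivAt (r j) (deriv (r j) (x j)) (x j) :=
        ((hrC j).differentiable one_ne_zero _).hasDerivAt
      have h3 : HasFDerivAt (fun x : Fin d → ℝ => x j)
          (ContinuousLinearMap.proj j : (Fin d → ℝ) →L[ℝ] ℝ) x :=
        (ContinuousLinearMap.proj j : (Fin d → ℝ) →L[ℝ] ℝ).hasFDerivAt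
      exact (h2.hasFDerivAt.comp x h3).congr_fderiv (by ext; simp))
    (by simp only [hF'i]; exact I1.add I2)
    (fun x hx => by
      simp only [hr, hprod]
      rcases hx with hx | hx <;> simp [hx, hWa, hWb])
  simp only [hF'i] at hzero
  rw [integral_add I1 I2] at hzero
  rw [← integral_const_mul]
  have : ∀ x, h x * ∏ j, q j (x j) = c * (h x * ∏ j, Function.update q i 1 j (x j)) -
      h x * ∏ j, Function.update q i (deriv W) j (x j) := by
    intro x
    rw [hprod0, hprod, hprod, hqW, Pi.one_apply]
    ring
  simp only [this]
  rw [integral_sub (I3.const_mul c) I1]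
  linear_combination -hzero

/-- Here s is the set of variables whose factors are controlled only through a primitive. Each
integration by parts removes one variable from s and costs at most one derivative of h, so C^d is
enough for all d variables. The bound does not depend on q beyond B. -/
lemma exists_norm_setIntegral_Icc_mul_prod_le {a b : Fin d → ℝ} (hab : ∀ i, a i < b i) {B : ℝ}
    (hB : 1 ≤ B) (s : Finset (Fin d)) :
    ∀ {n : ℕ}, s.card ≤ n → ∀ {h : (Fin d → ℝ) → ℂ}, ContDiffOn ℝ n h (Icc a b) →
      ∃ C, ∀ q : Fin d → ℝ → ℂ, (∀ j, ContDiff ℝ 1 (q j)) →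
        (∀ j ∉ s, ∀ t ∈ Icc (a j) (b j), ‖q j t‖ ≤ B) →
        (∀ j ∈ s, HasBoundedPrimitive B (a j) (b j) (q j)) →
        ‖∫ x in Icc a b, h x * ∏ j, q j (x j)‖ ≤ C := by
  induction s using Finset.induction_on with
  | empty =>
    intro n _ h hh
    obtain ⟨C, hC⟩ := isCompact_Icc.exists_bound_of_continuousOn hh.continuousOn
    refine ⟨C * B ^ d * volume.real (Icc a b), fun q _ hq2 _ => ?_⟩
    refine norm_setIntegral_le_of_norm_le_const isCompact_Icc.measure_lt_top fun x hx => ?_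
    rw [norm_mul, norm_prod]
    refine mul_le_mul (hC x hx) ?_ (by positivity) ((norm_nonneg _).trans (hC x hx))
    refine (Finset.prod_le_prod (fun _ _ => norm_nonneg _)
      fun j _ => hq2 j (by simp) (x j) ⟨hx.1 j, hx.2 j⟩).trans ?_
    simp
  | insert i s hi ih =>
    intro n hn h hh
    rw [Finset.card_insert_of_notMem hi] at hn
    obtain ⟨n, rfl⟩ : ∃ m, n = m + 1 := ⟨n - 1, by omega⟩
    have hn : s.card ≤ n := by omega
    have hud : UniqueDiffOn ℝ (Icc a b) := by
      refine uniqueDiffOn_convex (convex_Icc a b) ?_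
      rw [← pi_univ_Icc, interior_pi_set finite_univ, univ_pi_nonempty_iff]
      intro i
      simpa using hab i
    have hh1 : ContDiffOn ℝ n (fun x => fderivWithin ℝ h (Icc a b) x (Pi.single i 1))
        (Icc a b) :=
      (hh.fderivWithin hud (by norm_cast)).clm_apply contDiffOn_const
    obtain ⟨C₁, hC₁⟩ := ih hn (hh.of_le (by norm_cast; omega))
    obtain ⟨C₂, hC₂⟩ := ih hn hh1
    refine ⟨B * C₁ + C₂, fun q hqC hq1 hq2 => ?_⟩
    obtain ⟨c, W, hc, hW, hWB, hWa, hWb, hqW⟩ := hq2 i (by simp)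
    rw [setIntegral_Icc_mul_prod_eq hab i (hh.of_le (by norm_cast; omega)) hqC hW hWa hWb hqW]
    have aux : ∀ p : ℝ → ℂ, ContDiff ℝ 1 p → (∀ t ∈ Icc (a i) (b i), ‖p t‖ ≤ B) →
        (∀ j, ContDiff ℝ 1 (Function.update q i p j)) ∧
        (∀ j ∉ s, ∀ t ∈ Icc (a j) (b j), ‖Function.update q i p j t‖ ≤ B) ∧
        (∀ j ∈ s, HasBoundedPrimitive B (a j) (b j) (Function.update q i p j)) := by
      intro p hp hpB
      refine ⟨fun j => ?_, fun j hj => ?_, fun j hj => ?_⟩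
      · by_cases hj : j = i
        · subst hj; simpa using hp
        · simpa [hj] using hqC j
      · by_cases hji : j = i
        · subst hji; simpa using hpB
        · simpa [hji] using hq1 j (by simp [hji, hj])
      · have hji : j ≠ i := by rintro rfl; exact hi hj
        simpa [hji] using hq2 j (by simp [hj])
    -- The term with the constant c leaves the factor 1, which is where 1 ≤ B enters.
    obtain ⟨h1, h2, h3⟩ := aux 1 contDiff_const fun t _ => by simpa using hB
    obtain ⟨h4, h5, h6⟩ := aux W hW hWB
    refine (norm_add_le _ _).trans (add_le_add ?_ (hC₂ _ h4 h5 h6))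
    rw [norm_mul]
    exact mul_le_mul hc (hC₁ _ h1 h2 h3) (norm_nonneg _) (by linarith)

/-- Translates of the Dirichlet kernels have primitives that are bounded uniformly. -/
lemma hasBoundedPrimitive_dirichlet {a b : ℝ} (hab : a < b) :
    ∃ B : ℝ, 1 ≤ B ∧ ∀ (K : ℕ) (s : ℝ),
      HasBoundedPrimitive B a b (fun t => dirichlet K (t - s)) := by
  have hab' : 0 < b - a := sub_pos.2 hab
  set B₁ : ℝ := (b - a + 4) / (b - a) with hB₁
  set B₂ : ℝ := 2 * (b - a + 4) with hB₂
  have hB1 : 0 < B₁ := by positivity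
  refine ⟨B₁ + B₂, by linarith, fun K s => ?_⟩
  set E := dirichletPrimitive K with hE
  -- The primitive stays within 2 of the identity, so its increments over the interval are at most b
  -- - a + 4.
  have hE2 : ∀ t u : ℝ, u ∈ Icc a b → t ∈ Icc a b → |E (t - s) - E (u - s)| ≤ b - a + 4 := by
    intro t u hu ht
    have h1 := abs_le.1 (abs_dirichletPrimitive_sub_le K (t - s))
    have h2 := abs_le.1 (abs_dirichletPrimitive_sub_le K (u - s))
    obtain ⟨hu1, hu2⟩ := hu
    obtain ⟨ht1, ht2⟩ := ht
    rw [abs_le]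
    constructor <;> linarith
  have ha : a ∈ Icc a b := left_mem_Icc.2 hab.le
  have hb : b ∈ Icc a b := right_mem_Icc.2 hab.le
  -- The mean of the kernel over [a, b], the only constant for which W vanishes at b as well as at
  -- a.
  set c : ℝ := (E (b - s) - E (a - s)) / (b - a) with hc
  have hcB : |c| ≤ B₁ := by
    rw [hc, abs_div, abs_of_pos hab']
    exact div_le_div_of_nonneg_right (hE2 b a ha hb) hab'.le
  set W : ℝ → ℂ := fun t => (c : ℂ) * ((t : ℂ) - a) - ((E (t - s) : ℂ) - E (a - s)) with hW
  have hder : ∀ t, HasDerivAt W ((c : ℂ) - dirichlet K (t - s)) t := by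
    intro t
    have h1 : HasDerivAt (fun t : ℝ => (t : ℂ)) 1 t := (hasDerivAt_id t).ofReal_comp
    have h2 : HasDerivAt (fun t : ℝ => (E (t - s) : ℂ)) (dirichlet K (t - s)) t :=
      (hasDerivAt_dirichletPrimitive K (t - s)).comp_sub_const t s
    have := ((h1.sub_const (a : ℂ)).const_mul (c : ℂ)).sub (h2.sub_const (E (a - s) : ℂ))
    refine this.congr_deriv ?_
    simp
  have hd : deriv W = fun t => (c : ℂ) - dirichlet K (t - s) := funext fun t => (hder t).deriv
  refine ⟨c, W, ?_, ?_, ?_, ?_, ?_, ?_⟩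
  · rw [Complex.norm_real, Real.norm_eq_abs]
    linarith
  · rw [contDiff_one_iff_deriv, hd]
    refine ⟨fun t => (hder t).differentiableAt, continuous_const.sub ?_⟩
    exact (contDiff_dirichlet K).continuous.comp (by fun_prop)
  · intro t ht
    have : W t = ((c * (t - a) - (E (t - s) - E (a - s)) : ℝ) : ℂ) := by simp [hW]
    rw [this, Complex.norm_real, Real.norm_eq_abs]
    have h1 := hE2 t a ha ht
    have h2 : |c * (t - a)| ≤ b - a + 4 := by
      rw [abs_mul]
      calc |c| * |t - a| ≤ B₁ * (b - a) := by
            refine mul_le_mul hcB ?_ (abs_nonneg _) hB1.le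
            rw [abs_le]; constructor <;> linarith [ht.1, ht.2]
        _ = b - a + 4 := by rw [hB₁]; field_simp
    have h3 := abs_sub (c * (t - a)) (E (t - s) - E (a - s))
    linarith
  · simp [hW]
  · have : (c : ℂ) * ((b : ℂ) - a) = (E (b - s) : ℂ) - E (a - s) := by
      rw [hc]
      have : (b : ℂ) - a ≠ 0 := by exact_mod_cast hab'.ne'
      push_cast
      field_simp
    simp [hW, this]
  · intro t; rw [hd]; ring

/-- Integrals over a box of a `C^d` function against products of Dirichlet kernels are bounded. -/
lemma exists_norm_setIntegral_Icc_mul_prod_dirichlet_le {a b : Fin d → ℝ} (hab : ∀ i, a i < b i)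
    {h : (Fin d → ℝ) → ℂ} (hh : ContDiffOn ℝ d h (Icc a b)) :
    ∃ C, ∀ (K : ℕ) (s : Fin d → ℝ),
      ‖∫ x in Icc a b, h x * ∏ j, dirichlet K (x j - s j)‖ ≤ C := by
  choose B hB1 hB using fun i => hasBoundedPrimitive_dirichlet (hab i)
  have hBle : ∀ i, B i ≤ 1 + ∑ i, B i := fun i => by
    have := Finset.single_le_sum (fun j _ => zero_le_one.trans (hB1 j)) (Finset.mem_univ i)
    linarith
  have h1 : 1 ≤ 1 + ∑ i, B i := by
    have := Finset.sum_nonneg fun i (_ : i ∈ Finset.univ) => zero_le_one.trans (hB1 i)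
    linarith
  obtain ⟨C, hC⟩ := exists_norm_setIntegral_Icc_mul_prod_le hab h1 Finset.univ (by simp) hh
  refine ⟨C, fun K s => hC (fun j t => dirichlet K (t - s j)) (fun j => ?_) (by simp)
    fun j _ => ?_⟩
  · exact (contDiff_dirichlet K).comp (contDiff_id.sub contDiff_const)
  · obtain ⟨c, W, h1, h2, h3, h4⟩ := hB j K (s j)
    exact ⟨c, W, h1.trans (hBle j), h2, fun t ht => (h3 t ht).trans (hBle j), h4⟩

-- Periodization and Fourier series on the torus.

attribute [local instance] instMeasureSpaceUnitAddCircle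

lemma isProbabilityMeasure_unitAddCircle : IsProbabilityMeasure (volume : Measure UnitAddCircle) :=
  inferInstanceAs (IsProbabilityMeasure AddCircle.haarAddCircle)

attribute [local instance] isProbabilityMeasure_unitAddCircle

/-- The projection of `ℝ^d` onto the torus. -/
def toTorus (x : Fin d → ℝ) : UnitAddTorus (Fin d) := fun i => (x i : UnitAddCircle)

lemma measurable_toTorus : Measurable (toTorus (d := d)) :=
  measurable_pi_lambda _ fun i => AddCircle.measurable_mk'.comp (measurable_pi_apply i)

/-- The half-open unit cube with lower corner `l`. -/
def unitCube (l : Fin d → ℤ) : Set (Fin d → ℝ) :=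
  {x | ∀ i, x i ∈ Ioc (l i : ℝ) (l i + 1)}

lemma measurableSet_unitCube (l : Fin d → ℤ) : MeasurableSet (unitCube l) :=
  MeasurableSet.univ_pi' fun _ => measurableSet_Ioc

lemma iUnion_unitCube : ⋃ l, unitCube (d := d) l = univ := by
  refine eq_univ_of_forall fun x => mem_iUnion.2 ⟨fun i => ⌈x i⌉ - 1, fun i => ?_⟩
  push_cast
  exact ⟨by linarith [Int.ceil_lt_add_one (x i)], by linarith [Int.le_ceil (x i)]⟩

lemma pairwise_disjoint_unitCube : Pairwise (Function.onFun Disjoint (unitCube (d := d))) := by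
  intro l m hlm
  rw [Function.onFun, Set.disjoint_left]
  intro x hx hx'
  refine hlm (funext fun i => ?_)
  have h1 := hx i
  have h2 := hx' i
  have h3 : (l i : ℝ) < m i + 1 := h1.1.trans_le h2.2
  have h4 : (m i : ℝ) < l i + 1 := h2.1.trans_le h1.2
  have h3' : l i < m i + 1 := by exact_mod_cast h3
  have h4' : m i < l i + 1 := by exact_mod_cast h4
  omega

/-- On each of the countably many unit cubes the projection preserves measure. This lifts a.e.
convergence from the torus to ℝ^d. -/
lemma quasiMeasurePreserving_toTorus :
    Measure.QuasiMeasurePreserving (toTorus (d := d)) volume volume := by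
  refine ⟨measurable_toTorus, Measure.AbsolutelyContinuous.mk fun Z hZ h0 => ?_⟩
  rw [Measure.map_apply measurable_toTorus hZ, ← inter_univ (toTorus ⁻¹' Z), ← iUnion_unitCube,
    inter_iUnion, measure_iUnion_null_iff]
  intro l
  have h := UnitAddTorus.lintegral_preimage (Z.indicator (1 : UnitAddTorus (Fin d) → ENNReal)) (fun i => (l i : ℝ))
  rw [lintegral_indicator_one hZ, h0] at h
  have h2 : ∀ x : Fin d → ℝ, Z.indicator (1 : UnitAddTorus (Fin d) → ENNReal) (fun i => (x i : UnitAddCircle)) =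
      (toTorus ⁻¹' Z).indicator 1 x := fun x => rfl
  simp only [h2] at h
  rw [lintegral_indicator_one (measurable_toTorus hZ),
    Measure.restrict_apply (measurable_toTorus hZ)] at h
  exact h.symm

/-- The character `x ↦ e^{2πi(k,x)}`. -/
noncomputable def intChar (k : Fin d → ℤ) (x : Fin d → ℝ) : ℂ :=
  Complex.exp (2 * Real.pi * Complex.I * ∑ i, (k i : ℂ) * x i)

lemma mFourier_toTorus (k : Fin d → ℤ) (x : Fin d → ℝ) :
    UnitAddTorus.mFourier k (toTorus x) = intChar k x := by
  rw [intChar, Finset.mul_sum, Complex.exp_sum]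
  show ∏ i, fourier (k i) (toTorus x i) = _
  refine Finset.prod_congr rfl fun i _ => ?_
  rw [toTorus, fourier_coe_apply]
  congr 1
  push_cast
  ring

lemma norm_intChar (k : Fin d → ℤ) (x : Fin d → ℝ) : ‖intChar k x‖ = 1 := by
  have : 2 * Real.pi * Complex.I * ∑ i, (k i : ℂ) * x i =
      ((2 * Real.pi * ∑ i, (k i : ℝ) * x i : ℝ) : ℂ) * Complex.I := by push_cast; ring
  rw [intChar, this, Complex.norm_exp_ofReal_mul_I]

lemma continuous_intChar (k : Fin d → ℤ) : Continuous (intChar k) := by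
  unfold intChar; fun_prop

/-- The vector of `ℝ^d` with integer coordinates `l`. -/
def castVec (l : Fin d → ℤ) : Fin d → ℝ := fun i => (l i : ℝ)

lemma toTorus_add_castVec (x : Fin d → ℝ) (l : Fin d → ℤ) :
    toTorus (x + castVec l) = toTorus x := by
  funext i
  have : ((l i : ℝ) : UnitAddCircle) = 0 := by
    have h := AddCircle.coe_zsmul (p := (1 : ℝ)) (n := l i) (x := 1)
    rw [AddCircle.coe_period, smul_zero, zsmul_one] at h
    exact h
  simp only [toTorus, Pi.add_apply, castVec]
  rw [AddCircle.coe_add, this, add_zero]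

lemma intChar_add_castVec (k l : Fin d → ℤ) (x : Fin d → ℝ) :
    intChar k (x + castVec l) = intChar k x := by
  rw [← mFourier_toTorus, toTorus_add_castVec, mFourier_toTorus]

/-- The periodization of a function on `ℝ^d`. -/
noncomputable def periodize (g : (Fin d → ℝ) → ℂ) (x : Fin d → ℝ) : ℂ :=
  ∑' l : Fin d → ℤ, g (x + castVec l)

lemma periodize_add_castVec (g : (Fin d → ℝ) → ℂ) (x : Fin d → ℝ) (l : Fin d → ℤ) :
    periodize g (x + castVec l) = periodize g x := by
  rw [periodize, periodize, ← (Equiv.addLeft l).tsum_eq (fun m => g (x + castVec m))]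
  refine tsum_congr fun m => ?_
  congr 1
  funext i
  simp [castVec]
  ring

lemma measurable_periodize {g : (Fin d → ℝ) → ℂ} (hg : Measurable g) :
    Measurable (periodize g) :=
  Measurable.tsum fun l => hg.comp (measurable_id.add_const (castVec l))

/-- In coordinate i at most |b i - a i| + 1 integer shifts land in the box, so the series is a
finite sum of controlled length. -/
lemma exists_norm_periodize_le {g : (Fin d → ℝ) → ℂ} {a b : Fin d → ℝ}
    (hsupp : ∀ x ∉ Icc a b, g x = 0) {D : ℝ} (hD : ∀ x, ‖g x‖ ≤ D) (x : Fin d → ℝ) :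
    ‖periodize g x‖ ≤ (∏ i, (|b i - a i| + 1)) * D := by
  set s : Finset (Fin d → ℤ) := Fintype.piFinset fun i => Finset.Icc ⌈a i - x i⌉ ⌊b i - x i⌋
  have hs : ∀ l ∉ s, g (x + castVec l) = 0 := by
    intro l hl
    refine hsupp _ fun h => hl ?_
    rw [Fintype.mem_piFinset]
    intro i
    have h1 := h.1 i
    have h2 := h.2 i
    simp only [Pi.add_apply, castVec] at h1 h2
    rw [Finset.mem_Icc, Int.ceil_le, Int.le_floor]
    constructor <;> linarith
  rw [periodize, tsum_eq_sum hs]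
  refine (norm_sum_le _ _).trans ((Finset.sum_le_sum fun l _ => hD _).trans ?_)
  rw [Finset.sum_const, nsmul_eq_mul]
  refine mul_le_mul_of_nonneg_right ?_ ((norm_nonneg _).trans (hD 0))
  rw [Fintype.card_piFinset]
  push_cast
  refine Finset.prod_le_prod (fun _ _ => by positivity) fun i _ => ?_
  rw [Int.card_Icc]
  rcases le_or_gt (⌊b i - x i⌋ + 1 - ⌈a i - x i⌉) 0 with h | h
  · rw [Int.toNat_of_nonpos h]; push_cast; positivity
  · have : (((⌊b i - x i⌋ + 1 - ⌈a i - x i⌉).toNat : ℤ) : ℝ) =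
        ((⌊b i - x i⌋ + 1 - ⌈a i - x i⌉ : ℤ) : ℝ) := by rw [Int.toNat_of_nonneg h.le]
    rw [Int.cast_natCast] at this
    rw [this]
    push_cast
    have h1 := Int.floor_le (b i - x i)
    have h2 := Int.le_ceil (a i - x i)
    have h3 := le_abs_self (b i - a i)
    linarith

lemma setIntegral_unitCube {G : Type*} [NormedAddCommGroup G] [NormedSpace ℝ G]
    (f : (Fin d → ℝ) → G) (l : Fin d → ℤ) :
    ∫ x in unitCube l, f x = ∫ x in unitCube 0, f (x + castVec l) := by
  have h := (measurePreserving_add_right (volume : Measure (Fin d → ℝ))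
    (castVec l)).setIntegral_preimage_emb (measurableEmbedding_addRight (castVec l)) f (unitCube l)
  rw [← h]
  congr 2
  ext x
  simp [unitCube, castVec]
  refine forall_congr' fun i => ?_
  rw [add_comm (l i : ℝ) 1, add_le_add_iff_right]

/-- Unfolding the integral of a periodization. -/
lemma setIntegral_intChar_mul_periodize {g : (Fin d → ℝ) → ℂ} (hg : Integrable g)
    (k : Fin d → ℤ) :
    ∫ x in unitCube 0, intChar k x * periodize g x = ∫ x, intChar k x * g x := by
  have hF : Integrable fun x => intChar k x * g x :=
    hg.bdd_mul (continuous_intChar k).aestronglyMeasurable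
      (Eventually.of_forall fun x => (norm_intChar k x).le)
  have h1 : HasSum (fun l => ∫ x in unitCube l, intChar k x * g x)
      (∫ x, intChar k x * g x) := by
    have := hasSum_integral_iUnion (μ := volume) (fun l => measurableSet_unitCube (d := d) l)
      pairwise_disjoint_unitCube hF.integrableOn
    rwa [iUnion_unitCube, Measure.restrict_univ] at this
  have h2 : HasSum (fun l => ∫ x in unitCube l, ‖intChar k x * g x‖)
      (∫ x, ‖intChar k x * g x‖) := by
    have := hasSum_integral_iUnion (μ := volume) (fun l => measurableSet_unitCube (d := d) l)
      pairwise_disjoint_unitCube hF.norm.integrableOn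
    rwa [iUnion_unitCube, Measure.restrict_univ] at this
  have h3 := hasSum_integral_of_summable_integral_norm (μ := volume.restrict (unitCube (d := d) 0))
    (F := fun (l : Fin d → ℤ) x => intChar k (x + castVec l) * g (x + castVec l))
    (fun l => (hF.comp_add_right (castVec l)).integrableOn)
    (by
      refine h2.summable.congr fun l => ?_
      exact setIntegral_unitCube (fun x => ‖intChar k x * g x‖) l)
  simp only [intChar_add_castVec, tsum_mul_left] at h3
  refine h3.unique ?_
  refine h1.congr_fun fun l => ?_
  rw [setIntegral_unitCube (fun x => intChar k x * g x) l]
  simp only [intChar_add_castVec]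

/-- The cubic partial sums of the Fourier series of the periodization of `g`. -/
noncomputable def cubicFourierSum (g : (Fin d → ℝ) → ℂ) (K : ℕ) (s : Fin d → ℝ) : ℂ :=
  ∑ k ∈ Fintype.piFinset (fun _ : Fin d => Finset.Icc (-(K : ℤ)) (K : ℤ)),
    (∫ x, intChar k x * g x) * intChar (-k) s

lemma tendsto_cube_atTop :
    Tendsto (fun K : ℕ => Fintype.piFinset (fun _ : Fin d => Finset.Icc (-(K : ℤ)) (K : ℤ)))
      atTop atTop := by
  refine tendsto_atTop_finset_of_monotone (fun K K' h => ?_) fun k => ?_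
  · refine Fintype.piFinset_subset _ _ fun i => Finset.Icc_subset_Icc ?_ ?_ <;> simpa using h
  · refine ⟨∑ i, (k i).natAbs, ?_⟩
    rw [Fintype.mem_piFinset]
    intro i
    have := Finset.single_le_sum (f := fun i => (k i).natAbs) (fun _ _ => Nat.zero_le _)
      (Finset.mem_univ i)
    rw [Finset.mem_Icc]
    omega

/-- The periodization is bounded, hence in L² of the torus, where its Fourier series converges;
convergence in L² implies convergence in measure, which gives a subsequence converging a.e. -/
lemma exists_subseq_tendsto_cubicFourierSum {g : (Fin d → ℝ) → ℂ} {a b : Fin d → ℝ}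
    (hg : Measurable g) (hsupp : ∀ x ∉ Icc a b, g x = 0) {D : ℝ} (hD : ∀ x, ‖g x‖ ≤ D)
    {ns : ℕ → ℕ} (hns : Tendsto ns atTop atTop) :
    ∃ ms : ℕ → ℕ, ∀ᵐ s : Fin d → ℝ,
      Tendsto (fun i => cubicFourierSum g (ns (ms i)) s) atTop (𝓝 (periodize g s)) := by
  have hgi : Integrable g := by
    have h1 : IntegrableOn g (Icc a b) :=
      Measure.integrableOn_of_bounded isCompact_Icc.measure_lt_top.ne hg.aestronglyMeasurable
        (M := D) (Eventually.of_forall hD)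
    exact (integrableOn_iff_integrable_of_support_subset
      (fun x hx => by_contra fun h => hx (hsupp x h))).1 h1
  -- The periodization read on the torus through representatives in (0, 1]^d; periodicity makes the
  -- choice immaterial.
  set G : UnitAddTorus (Fin d) → ℂ :=
    fun t => periodize g (UnitAddTorus.measurableEquivPiIoc (fun _ => (0 : ℝ)) t).1 with hG
  have hGm : Measurable G := (measurable_periodize hg).comp
    (measurable_subtype_coe.comp (UnitAddTorus.measurableEquivPiIoc fun _ => (0 : ℝ)).measurable)
  have hGp : ∀ x, G (toTorus x) = periodize g x := by
    intro x
    set y := UnitAddTorus.measurableEquivPiIoc (fun _ => (0 : ℝ)) (toTorus x) with hy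
    have hyx : toTorus y.1 = toTorus x := by
      have := (UnitAddTorus.measurableEquivPiIoc fun _ : Fin d => (0 : ℝ)).symm_apply_apply
        (toTorus x)
      rw [UnitAddTorus.coe_symm_measurableEquivPiIoc_apply] at this
      exact this
    have : ∃ l : Fin d → ℤ, y.1 = x + castVec l := by
      have h : ∀ i, ∃ n : ℤ, y.1 i = x i + n := by
        intro i
        have h := congrFun hyx i
        simp only [toTorus] at h
        rw [← sub_eq_zero, ← AddCircle.coe_sub, AddCircle.coe_eq_zero_iff] at h
        obtain ⟨n, hn⟩ := h
        refine ⟨n, ?_⟩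
        rw [zsmul_one] at hn
        linarith
      choose l hl using h
      exact ⟨l, funext hl⟩
    obtain ⟨l, hl⟩ := this
    show periodize g y.1 = _
    rw [hl, periodize_add_castVec]
  have hG2 : MemLp G 2 volume := MemLp.of_bound hGm.aestronglyMeasurable _
    (Eventually.of_forall fun t => exists_norm_periodize_le hsupp hD _)
  have hcoef : ∀ n : Fin d → ℤ, UnitAddTorus.mFourierCoeff (hG2.toLp G) n =
      ∫ x, intChar (-n) x * g x := by
    intro n
    have h1 : UnitAddTorus.mFourierCoeff (hG2.toLp G) n = UnitAddTorus.mFourierCoeff G n := by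
      refine integral_congr_ae ?_
      filter_upwards [hG2.coeFn_toLp] with t ht
      rw [ht]
    rw [h1, UnitAddTorus.mFourierCoeff_eq_integral _ _ (fun _ => (0 : ℝ)),
      ← setIntegral_intChar_mul_periodize hgi]
    have h2 : {x : Fin d → ℝ | ∀ i, x i ∈ Ioc (0 : ℝ) (0 + 1)} = unitCube 0 := by
      simp [unitCube]
    rw [h2]
    refine integral_congr_ae (Eventually.of_forall fun x => ?_)
    show UnitAddTorus.mFourier (-n) (toTorus x) • G (toTorus x) = _
    rw [mFourier_toTorus, hGp, smul_eq_mul]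
  have hsum := (UnitAddTorus.hasSum_mFourier_series_L2 (hG2.toLp G)).comp
    ((tendsto_cube_atTop (d := d)).comp hns)
  obtain ⟨ms, -, hms⟩ := (tendstoInMeasure_of_tendsto_Lp hsum).exists_seq_tendsto_ae
  refine ⟨ms, ?_⟩
  set cube : ℕ → Finset (Fin d → ℤ) :=
    fun K => Fintype.piFinset (fun _ : Fin d => Finset.Icc (-(K : ℤ)) (K : ℤ)) with hcube
  have hae : ∀ᵐ t : UnitAddTorus (Fin d), ∀ K,
      (∑ n ∈ cube K, UnitAddTorus.mFourierCoeff (hG2.toLp G) n •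
        UnitAddTorus.mFourierLp 2 n : Lp ℂ 2 (volume : Measure (UnitAddTorus (Fin d)))) t =
      ∑ n ∈ cube K, (∫ x, intChar (-n) x * g x) * UnitAddTorus.mFourier n t := by
    rw [ae_all_iff]
    intro K
    have h1 : ∀ᵐ t : UnitAddTorus (Fin d), ∀ n : Fin d → ℤ,
        UnitAddTorus.mFourierLp 2 n t = UnitAddTorus.mFourier n t :=
      ae_all_iff.2 fun n => UnitAddTorus.coeFn_mFourierLp 2 n
    have h2 : ∀ᵐ t : UnitAddTorus (Fin d), ∀ n : Fin d → ℤ,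
        (UnitAddTorus.mFourierCoeff (hG2.toLp G) n • UnitAddTorus.mFourierLp 2 n :
          Lp ℂ 2 (volume : Measure (UnitAddTorus (Fin d)))) t =
        UnitAddTorus.mFourierCoeff (hG2.toLp G) n • UnitAddTorus.mFourierLp 2 n t :=
      ae_all_iff.2 fun n => Lp.coeFn_smul _ _
    have h3 := Lp.coeFn_finsetSum (cube K) (fun n =>
      (UnitAddTorus.mFourierCoeff (hG2.toLp G) n • UnitAddTorus.mFourierLp 2 n :
        Lp ℂ 2 (volume : Measure (UnitAddTorus (Fin d)))))
    filter_upwards [h1, h2, h3] with t h1 h2 h3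
    rw [h3, Finset.sum_apply]
    refine Finset.sum_congr rfl fun n _ => ?_
    rw [h2, h1, hcoef, smul_eq_mul]
  have hall : ∀ᵐ t : UnitAddTorus (Fin d),
      Tendsto (fun i => ∑ n ∈ cube (ns (ms i)),
        (∫ x, intChar (-n) x * g x) * UnitAddTorus.mFourier n t) atTop (𝓝 (G t)) := by
    filter_upwards [hae, hms, hG2.coeFn_toLp] with t h1 h2 h3
    rw [h3] at h2
    simpa only [Function.comp_apply, ← h1] using h2
  filter_upwards [quasiMeasurePreserving_toTorus.ae hall] with s hs
  rw [hGp] at hs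
  refine hs.congr fun i => ?_
  rw [cubicFourierSum]
  -- Torus coefficients integrate against the conjugate character, so the index changes sign; the
  -- cubes are symmetric.
  refine Finset.sum_equiv (Equiv.neg _) (fun k => ?_) fun k _ => ?_
  · simp only [hcube, Fintype.mem_piFinset, Finset.mem_Icc, Equiv.neg_apply, Pi.neg_apply]
    refine forall_congr' fun i => ?_
    omega
  · rw [mFourier_toTorus]
    simp

/-- If the cubic partial sums of the Fourier series of a periodization are uniformly bounded, then
they converge weakly to the periodization. -/
lemma tendsto_integral_mul_cubicFourierSum {X : Type*} [MeasurableSpace X] {μ : Measure X}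
    {F : X → ℂ} (hF : Integrable F μ) {p : X → Fin d → ℝ}
    (hp : Measure.QuasiMeasurePreserving p μ volume) {g : (Fin d → ℝ) → ℂ} {a b : Fin d → ℝ}
    (hg : Measurable g) (hsupp : ∀ x ∉ Icc a b, g x = 0) {D : ℝ} (hD : ∀ x, ‖g x‖ ≤ D)
    {C : ℝ} (hC : ∀ K s, ‖cubicFourierSum g K s‖ ≤ C) :
    Tendsto (fun K => ∫ x, F x * cubicFourierSum g K (p x) ∂μ) atTop
      (𝓝 (∫ x, F x * periodize g (p x) ∂μ)) := by
  -- A.e. convergence is known only along subsequences, but the limit is always the same, so the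
  -- whole sequence of integrals converges.
  refine tendsto_of_subseq_tendsto fun ns hns => ?_
  obtain ⟨ms, hms⟩ := exists_subseq_tendsto_cubicFourierSum hg hsupp hD hns
  refine ⟨ms, tendsto_integral_of_dominated_convergence (fun x => ‖F x‖ * C) (fun i => ?_)
    (hF.norm.mul_const C) (fun i => Eventually.of_forall fun x => ?_) ?_⟩
  · refine hF.aestronglyMeasurable.mul ?_
    have hc : Continuous (cubicFourierSum g (ns (ms i))) := by
      unfold cubicFourierSum
      exact continuous_finsetSum _ fun k _ => continuous_const.mul (continuous_intChar _)
    exact (hc.measurable.comp hp.measurable).aestronglyMeasurable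
  · rw [norm_mul]
    exact mul_le_mul_of_nonneg_left (hC _ _) (norm_nonneg _)
  · filter_upwards [hp.ae hms] with x hx
    exact hx.const_mul _

/-! ### Fourier inversion and identification of distributions with functions. -/

/-- Fubini; the kernel e^{2πi(ξ,x)} is symmetric in its two variables. -/
lemma integral_fourierInv_mul {f g : E d → ℂ} (hf : Integrable f) (hg : Integrable g) :
    ∫ ξ, 𝓕⁻ f ξ * g ξ = ∫ x, f x * 𝓕⁻ g x :=
  VectorFourier.integral_fourierIntegral_smul_eq_flip (L := -innerₗ (E d))
    Real.continuous_fourierChar (by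
      have : (fun p : E d × E d => (-innerₗ (E d)) p.1 p.2) = fun p => -inner ℝ p.1 p.2 := by
        ext p; simp
      rw [this]
      exact continuous_inner.neg) hf hg |>.trans (by
    have : (-innerₗ (E d)).flip = -innerₗ (E d) := by
      ext x y
      simp [real_inner_comm]
    rw [this]
    rfl)

lemma continuous_fourierInv {f : E d → ℂ} (hf : Integrable f) : Continuous (𝓕⁻ f) := by
  rw [Real.fourierInv_eq_fourier_comp_neg]
  exact VectorFourier.fourierIntegral_continuous Real.continuous_fourierChar continuous_inner
    hf.comp_neg

lemma norm_fourierInv_le (f : E d → ℂ) (x : E d) : ‖𝓕⁻ f x‖ ≤ ∫ ξ, ‖f ξ‖ := by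
  rw [Real.fourierInv_eq]
  refine (norm_integral_le_integral_norm _).trans_eq ?_
  simp

open scoped ContDiff in
/-- Two functions that define the same distribution agree almost everywhere. -/
lemma IsGivenBy.ae_eq {T : 𝓢'(E d, ℂ)} {u w : E d → ℂ} (hu : IsGivenBy T u)
    (hw : LocallyIntegrable w)
    (h : ∀ ψ : 𝓢(E d, ℂ), HasCompactSupport ψ → T ψ = ∫ x, ψ x * w x) :
    ∀ᵐ x, u x = w x := by
  refine ae_eq_of_integral_contDiff_smul_eq hu.1 hw fun g hg hgc => ?_
  have hg1 : HasCompactSupport (fun x => (g x : ℂ)) := hgc.comp_left Complex.ofReal_zero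
  have hg2 : ContDiff ℝ ∞ (fun x => (g x : ℂ)) := Complex.ofRealCLM.contDiff.comp hg
  set ψ : 𝓢(E d, ℂ) := hg1.toSchwartzMap hg2 with hψ
  have hψg : ∀ x, ψ x = (g x : ℂ) := fun x => rfl
  have hint : Integrable (fun x => ψ x * u x) :=
    hu.1.integrable_smul_left_of_hasCompactSupport hg2.continuous hg1
  have h1 := (hu.2 ψ hint).symm.trans (h ψ hg1)
  simpa only [hψg, Complex.real_smul] using h1

lemma fourier_apply_fourierInv (T : 𝓢'(E d, ℂ)) (χ : 𝓢(E d, ℂ)) : 𝓕 T (𝓕⁻ χ) = T χ := by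
  rw [TemperedDistribution.fourier_apply, FourierTransform.fourier_fourierInv_eq]

/-- Fourier inversion for continuous functions with an integrable Fourier transform. -/
lemma IsFourierOf.eq_fourierInv {f fhat : E d → ℂ} (h : IsFourierOf fhat f) (hf : Continuous f)
    (hfhat : Integrable fhat) : f = 𝓕⁻ fhat := by
  obtain ⟨T, hT, hFT⟩ := h
  have hae : ∀ᵐ x, f x = 𝓕⁻ fhat x := by
    -- Duality: T χ = (𝓕 T)(𝓕⁻ χ) = ∫ 𝓕⁻χ · f̂ = ∫ χ · 𝓕⁻f̂.
    refine hT.ae_eq (continuous_fourierInv hfhat).locallyIntegrable fun χ _ => ?_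
    have hb : Integrable (fun ξ => (𝓕⁻ χ) ξ * fhat ξ) := by
      refine hfhat.bdd_mul (𝓕⁻ χ).continuous.aestronglyMeasurable
        (c := ∫ x, ‖χ x‖) (Eventually.of_forall fun ξ => ?_)
      rw [SchwartzMap.fourierInv_coe]
      exact norm_fourierInv_le χ ξ
    rw [← fourier_apply_fourierInv, hFT.2 _ hb]
    simp only [SchwartzMap.fourierInv_coe]
    exact integral_fourierInv_mul χ.integrable hfhat
  -- Both sides are continuous, so equality a.e. is equality everywhere.
  exact (Continuous.ae_eq_iff_eq volume hf (continuous_fourierInv hfhat)).1 hae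

/-- The Fourier transform, in the sense of distributions, of an inverse Fourier transform. -/
lemma IsFourierOf.ae_eq_of_fourierInv {v θ : E d → ℂ} (h : IsFourierOf v (𝓕⁻ θ))
    (hθ : Integrable θ) : ∀ᵐ ξ, v ξ = θ ξ := by
  obtain ⟨T, hT, hFT⟩ := h
  refine hFT.ae_eq hθ.locallyIntegrable fun ψ _ => ?_
  have hb : Integrable (fun ξ => (𝓕 ψ) ξ * 𝓕⁻ θ ξ) :=
    (𝓕 ψ).integrable.mul_bdd (continuous_fourierInv hθ).aestronglyMeasurable
      (c := ∫ x, ‖θ x‖) (Eventually.of_forall fun ξ => norm_fourierInv_le θ ξ)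
  rw [TemperedDistribution.fourier_apply, hT.2 _ hb]
  have h1 := integral_fourierInv_mul (𝓕 ψ).integrable hθ
  rw [← h1, ← SchwartzMap.fourierInv_coe, FourierTransform.fourierInv_fourier_eq]

/-! ### The symbol of L and the Fourier transform of its distribution. -/

/-- The monomial `(2πiξ)^β`. -/
noncomputable def freqMonomial (β : Fin d → ℕ) (ξ : E d) : ℂ :=
  ∏ i, (2 * Real.pi * Complex.I * (ξ i : ℂ)) ^ β i

/-- The symbol of the operator `∑ a_β D^β`. -/
noncomputable def symbol (N : ℕ) (a : (Fin d → ℕ) → ℂ) (ξ : E d) : ℂ :=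
  ∑ β ∈ multiIndices d N, a β * freqMonomial β ξ

lemma continuous_freqMonomial (β : Fin d → ℕ) : Continuous (freqMonomial (d := d) β) := by
  unfold freqMonomial; fun_prop

lemma continuous_symbol (N : ℕ) (a : (Fin d → ℕ) → ℂ) : Continuous (symbol (d := d) N a) :=
  continuous_finsetSum _ fun β _ => continuous_const.mul (continuous_freqMonomial β)

lemma inner_stdVec (ξ : E d) (i : Fin d) : inner ℝ ξ (stdVec i) = ξ i := by
  simp [stdVec, EuclideanSpace.inner_single_right]

lemma fourier_lineDerivOp_apply {U : 𝓢'(E d, ℂ)} {p : E d → ℂ}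
    (h : ∀ ψ : 𝓢(E d, ℂ), 𝓕 U ψ = ∫ x, ψ x * p x) (i : Fin d) (ψ : 𝓢(E d, ℂ)) :
    𝓕 (∂_{stdVec i} U) ψ = ∫ x, ψ x * ((2 * Real.pi * Complex.I * (x i : ℂ)) * p x) := by
  have hg : (fun x : E d => ((inner ℝ x (stdVec i) : ℝ) : ℂ)).HasTemperateGrowth := by fun_prop
  rw [TemperedDistribution.fourier_lineDerivOp_eq]
  show (2 * Real.pi * Complex.I) • (TemperedDistribution.smulLeftCLM ℂ _ (𝓕 U)) ψ = _
  rw [TemperedDistribution.smulLeftCLM_apply_apply, h, smul_eq_mul, ← integral_const_mul]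
  refine integral_congr_ae (Eventually.of_forall fun x => ?_)
  beta_reduce
  rw [SchwartzMap.smulLeftCLM_apply_apply hg, inner_stdVec, smul_eq_mul]
  ring

lemma fourier_iterate_lineDerivOp_apply {U : 𝓢'(E d, ℂ)} {p : E d → ℂ}
    (h : ∀ ψ : 𝓢(E d, ℂ), 𝓕 U ψ = ∫ x, ψ x * p x) (i : Fin d) (n : ℕ) (ψ : 𝓢(E d, ℂ)) :
    𝓕 ((fun V : 𝓢'(E d, ℂ) => ∂_{stdVec i} V)^[n] U) ψ =
      ∫ x, ψ x * ((2 * Real.pi * Complex.I * (x i : ℂ)) ^ n * p x) := by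
  induction n generalizing ψ with
  | zero => simpa using h ψ
  | succ n ih =>
    rw [Function.iterate_succ_apply', fourier_lineDerivOp_apply ih]
    simp only [pow_succ', mul_assoc]

lemma fourier_foldr_lineDerivOp_apply {U : 𝓢'(E d, ℂ)} {p : E d → ℂ}
    (h : ∀ ψ : 𝓢(E d, ℂ), 𝓕 U ψ = ∫ x, ψ x * p x) (β : Fin d → ℕ) (l : List (Fin d))
    (ψ : 𝓢(E d, ℂ)) :
    𝓕 (l.foldr (fun i U => (fun V : 𝓢'(E d, ℂ) => ∂_{stdVec i} V)^[β i] U) U) ψ =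
      ∫ x, ψ x * ((l.map fun i => (2 * Real.pi * Complex.I * (x i : ℂ)) ^ β i).prod * p x) := by
  induction l generalizing ψ with
  | nil => simpa using h ψ
  | cons i l ih =>
    rw [List.foldr_cons, fourier_iterate_lineDerivOp_apply ih]
    simp only [List.map_cons, List.prod_cons, mul_assoc]

/-- The Fourier transform of δ is the constant 1, and each derivative contributes a factor 2πi x_i.
-/
lemma fourier_distDeriv_delta_apply (β : Fin d → ℕ) (ψ : 𝓢(E d, ℂ)) :
    𝓕 (distDeriv β (TemperedDistribution.delta (0 : E d))) ψ = ∫ x, ψ x * freqMonomial β x := by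
  have h0 : ∀ ψ : 𝓢(E d, ℂ), 𝓕 (TemperedDistribution.delta (0 : E d)) ψ = ∫ x, ψ x * 1 := by
    intro ψ
    rw [TemperedDistribution.fourier_delta_zero]
    simp
  rw [distDeriv, fourier_foldr_lineDerivOp_apply h0]
  simp only [mul_one, freqMonomial, Fin.prod_univ_def]

/-- Every factor is purely imaginary. This is why the signs (-1)^{[β]} in the distribution turn its
Fourier transform into the conjugate of the symbol. -/
lemma conj_freqMonomial (β : Fin d → ℕ) (ξ : E d) :
    conj (freqMonomial β ξ) = (-1) ^ (∑ i, β i) * freqMonomial β ξ := by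
  rw [freqMonomial, map_prod, ← Finset.prod_pow_eq_pow_sum, ← Finset.prod_mul_distrib]
  refine Finset.prod_congr rfl fun i _ => ?_
  rw [map_pow, ← mul_pow]
  congr 1
  simp only [map_mul, Complex.conj_I, Complex.conj_ofReal, map_ofNat]
  ring

/-- The Fourier transform of the distribution associated with `L` is the conjugate of the symbol. -/
lemma IsGivenBy.ae_eq_conj_symbol {N : ℕ} {a : (Fin d → ℕ) → ℂ} {u : E d → ℂ}
    (hu : IsGivenBy (𝓕 (assocDist N a)) u) : ∀ᵐ ξ, u ξ = conj (symbol N a ξ) := by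
  refine hu.ae_eq (Complex.continuous_conj.comp (continuous_symbol N a)).locallyIntegrable
    fun ψ hψ => ?_
  have hsum : 𝓕 (assocDist N a) ψ = ∑ β ∈ multiIndices d N,
      (conj (a β) * (-1) ^ (∑ i, β i)) *
        𝓕 (distDeriv β (TemperedDistribution.delta (0 : E d))) ψ := by
    simp only [TemperedDistribution.fourier_apply, assocDist]
    rw [sum_apply]
    rfl
  rw [hsum]
  simp only [fourier_distDeriv_delta_apply, ← integral_const_mul]
  rw [← integral_finsetSum]
  · refine integral_congr_ae (Eventually.of_forall fun x => ?_)
    simp only [symbol, map_sum, map_mul, conj_freqMonomial, Finset.mul_sum]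
    refine Finset.sum_congr rfl fun β _ => ?_
    ring
  · intro β _
    refine Integrable.const_mul ?_ _
    exact (ψ.continuous.mul (continuous_freqMonomial β)).integrable_of_hasCompactSupport
      hψ.mul_right

/-! ### Differentiating superpositions of exponentials. -/

/-- The superposition `y ↦ ∫ e^{2πi(Bη,y)} c(η) dη` of exponentials. -/
noncomputable def expIntegral (B : E d →L[ℝ] E d) (c : E d → ℂ) (y : E d) : ℂ :=
  ∫ η, Complex.exp (2 * Real.pi * Complex.I * (inner ℝ (B η) y : ℝ)) * c η

lemma norm_exp_two_pi_I_mul (t : ℝ) : ‖Complex.exp (2 * Real.pi * Complex.I * t)‖ = 1 := by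
  have : 2 * Real.pi * Complex.I * t = ((2 * Real.pi * t : ℝ) : ℂ) * Complex.I := by
    push_cast; ring
  rw [this, Complex.norm_exp_ofReal_mul_I]

lemma fourierChar_eq_exp (t : ℝ) :
    (Real.fourierChar t : ℂ) = Complex.exp (2 * Real.pi * Complex.I * t) := by
  rw [Real.fourierChar_apply]
  congr 1
  push_cast
  ring

/-- The pairing `(η, y) ↦ -(Bη, y)`. -/
noncomputable def negPairing (B : E d →L[ℝ] E d) : E d →L[ℝ] E d →L[ℝ] ℝ :=
  -((innerSL ℝ).comp B)

lemma negPairing_apply (B : E d →L[ℝ] E d) (η y : E d) : negPairing B η y = -inner ℝ (B η) y := rfl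

lemma expIntegral_eq_fourierIntegral (B : E d →L[ℝ] E d) (c : E d → ℂ) :
    expIntegral B c =
      VectorFourier.fourierIntegral Real.fourierChar volume (negPairing B).toLinearMap₁₂ c := by
  funext y
  refine integral_congr_ae (Eventually.of_forall fun η => ?_)
  simp only [ContinuousLinearMap.toLinearMap₁₂_apply_apply_apply, negPairing_apply, neg_neg,
    Circle.smul_def, fourierChar_eq_exp, smul_eq_mul]

lemma fourierInv_eq_expIntegral (c : E d → ℂ) (x : E d) :
    𝓕⁻ c x = ∫ η, Complex.exp (2 * Real.pi * Complex.I * (inner ℝ η x : ℝ)) * c η := by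
  rw [Real.fourierInv_eq]
  simp only [Circle.smul_def, fourierChar_eq_exp, smul_eq_mul]

/-- The function `c` has integrable moments up to order `n`. -/
def HasMoments (n : ℕ) (c : E d → ℂ) : Prop :=
  AEStronglyMeasurable c volume ∧ ∀ m ≤ n, Integrable fun η => ‖η‖ ^ m * ‖c η‖

lemma HasMoments.mono {m n : ℕ} {c : E d → ℂ} (h : HasMoments n c) (hmn : m ≤ n) :
    HasMoments m c :=
  ⟨h.1, fun k hk => h.2 k (hk.trans hmn)⟩

lemma HasMoments.integrable {n : ℕ} {c : E d → ℂ} (h : HasMoments n c) : Integrable c := by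
  have := h.2 0 (Nat.zero_le _)
  simp only [pow_zero, one_mul] at this
  exact (integrable_norm_iff h.1).1 this

lemma norm_freq_le (B : E d →L[ℝ] E d) (i : Fin d) (η : E d) :
    ‖2 * Real.pi * Complex.I * ((B η) i : ℂ)‖ ≤ 2 * Real.pi * ‖B‖ * ‖η‖ := by
  rw [norm_mul, norm_mul, norm_mul, Complex.norm_I, mul_one, Complex.norm_real, Complex.norm_real,
    Complex.norm_ofNat, Real.norm_of_nonneg Real.pi_pos.le, mul_assoc (2 * Real.pi)]
  refine mul_le_mul_of_nonneg_left ?_ (by positivity)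
  exact (PiLp.norm_apply_le _ i).trans (B.le_opNorm η)

/-- The frequency factor is at most a constant times ‖η‖, so it costs one moment. -/
lemma HasMoments.freq_mul {n : ℕ} {c : E d → ℂ} (h : HasMoments (n + 1) c)
    (B : E d →L[ℝ] E d) (i : Fin d) :
    HasMoments n fun η => 2 * Real.pi * Complex.I * ((B η) i : ℂ) * c η := by
  have hm : AEStronglyMeasurable
      (fun η => 2 * Real.pi * Complex.I * ((B η) i : ℂ) * c η) volume :=
    (Continuous.aestronglyMeasurable (by fun_prop)).mul h.1
  refine ⟨hm, fun m hmn => ?_⟩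
  refine ((h.2 (m + 1) (by omega)).const_mul (2 * Real.pi * ‖B‖)).mono'
    ((Continuous.aestronglyMeasurable (by fun_prop)).mul hm.norm)
    (Eventually.of_forall fun η => ?_)
  rw [norm_mul, norm_norm, norm_mul _ (c η), norm_pow, norm_norm]
  calc ‖η‖ ^ m * (‖2 * Real.pi * Complex.I * ((B η) i : ℂ)‖ * ‖c η‖)
      ≤ ‖η‖ ^ m * ((2 * Real.pi * ‖B‖ * ‖η‖) * ‖c η‖) := by
        gcongr
        exact norm_freq_le B i η
    _ = 2 * Real.pi * ‖B‖ * (‖η‖ ^ (m + 1) * ‖c η‖) := by ring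

/-- Differentiation under the integral, justified by the first moment. -/
lemma lineDeriv_expIntegral {c : E d → ℂ} (h : HasMoments 1 c) (B : E d →L[ℝ] E d) (i : Fin d) :
    (fun y => lineDeriv ℝ (expIntegral B c) y (stdVec i)) =
      expIntegral B fun η => 2 * Real.pi * Complex.I * ((B η) i : ℂ) * c η := by
  funext y
  have h1 := h.2 1 le_rfl
  simp only [pow_one] at h1
  have hd := VectorFourier.hasFDerivAt_fourierIntegral (negPairing B) h.integrable h1 y
  rw [← expIntegral_eq_fourierIntegral] at hd
  rw [(hd.hasLineDerivAt (stdVec i)).lineDeriv, expIntegral_eq_fourierIntegral,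
    VectorFourier.fourierIntegral_continuousLinearMap_apply Real.continuous_fourierChar]
  · congr 1
    funext η
    rw [VectorFourier.fourierSMulRight_apply, negPairing_apply, inner_stdVec]
    rw [Complex.real_smul, smul_eq_mul]
    push_cast
    ring
  · refine (h1.const_mul (2 * Real.pi * ‖negPairing B‖)).mono' h.1.fourierSMulRight
      (Eventually.of_forall fun η => ?_)
    rw [← mul_assoc]
    exact VectorFourier.norm_fourierSMulRight_le _ _ _

/-- The n moments left over are what allows the derivatives in the other variables to be taken
afterwards. -/
lemma iterate_lineDeriv_expIntegral {n k : ℕ} {c : E d → ℂ} (h : HasMoments (n + k) c)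
    (B : E d →L[ℝ] E d) (i : Fin d) :
    (fun (h : E d → ℂ) x => lineDeriv ℝ h x (stdVec i))^[k] (expIntegral B c) =
        expIntegral B (fun η => (2 * Real.pi * Complex.I * ((B η) i : ℂ)) ^ k * c η) ∧
      HasMoments n (fun η => (2 * Real.pi * Complex.I * ((B η) i : ℂ)) ^ k * c η) := by
  induction k generalizing n with
  | zero => simpa using h
  | succ k ih =>
    obtain ⟨h1, h2⟩ := ih (n := n + 1) (h.mono (by omega))
    rw [Function.iterate_succ_apply', h1, lineDeriv_expIntegral (h2.mono (by omega))]
    have h3 := h2.freq_mul B i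
    simp only [← mul_assoc, ← pow_succ'] at h3 ⊢
    exact ⟨trivial, h3⟩

lemma foldr_lineDeriv_expIntegral {n : ℕ} (β : Fin d → ℕ) (l : List (Fin d)) {c : E d → ℂ}
    (h : HasMoments (n + (l.map β).sum) c) (B : E d →L[ℝ] E d) :
    l.foldr (fun i g => (fun (h : E d → ℂ) x => lineDeriv ℝ h x (stdVec i))^[β i] g)
          (expIntegral B c) =
        expIntegral B (fun η =>
          (l.map fun i => (2 * Real.pi * Complex.I * ((B η) i : ℂ)) ^ β i).prod * c η) ∧
      HasMoments n (fun η =>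
          (l.map fun i => (2 * Real.pi * Complex.I * ((B η) i : ℂ)) ^ β i).prod * c η) := by
  induction l generalizing n with
  | nil => simpa using h
  | cons i l ih =>
    rw [List.map_cons, List.sum_cons, ← add_assoc] at h
    obtain ⟨h1, h2⟩ := ih h
    obtain ⟨h3, h4⟩ := iterate_lineDeriv_expIntegral h2 B i
    rw [List.foldr_cons, h1, h3]
    simp only [← mul_assoc, List.map_cons, List.prod_cons] at h4 ⊢
    exact ⟨trivial, h4⟩

lemma funDeriv_expIntegral {N : ℕ} {β : Fin d → ℕ} (hβ : ∑ i, β i ≤ N) {c : E d → ℂ}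
    (h : HasMoments N c) (B : E d →L[ℝ] E d) :
    funDeriv β (expIntegral B c) = expIntegral B (fun η => freqMonomial β (B η) * c η) ∧
      Integrable (fun η => freqMonomial β (B η) * c η) := by
  have h0 : HasMoments (0 + ((List.finRange d).map β).sum) c := by
    rw [zero_add, ← Fin.sum_univ_def]
    exact h.mono hβ
  obtain ⟨h1, h2⟩ := foldr_lineDeriv_expIntegral β (List.finRange d) h0 B
  simp only [← Fin.prod_univ_def] at h1 h2
  exact ⟨h1, h2.integrable⟩

lemma sum_le_of_mem_multiIndices {N : ℕ} {β : Fin d → ℕ} (hβ : β ∈ multiIndices d N) :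
    ∑ i, β i ≤ N :=
  (Finset.mem_filter.1 hβ).2

lemma HasMoments.integrable_symbol_mul {N : ℕ} {c : E d → ℂ} (h : HasMoments N c)
    (a : (Fin d → ℕ) → ℂ) (B : E d →L[ℝ] E d) :
    Integrable fun η => symbol N a (B η) * c η := by
  simp only [symbol, Finset.sum_mul, mul_assoc]
  exact integrable_finsetSum _ fun β hβ =>
    (funDeriv_expIntegral (sum_le_of_mem_multiIndices hβ) h B).2.const_mul _

lemma HasMoments.diffOp_expIntegral {N : ℕ} {c : E d → ℂ} (h : HasMoments N c)
    (a : (Fin d → ℕ) → ℂ) (B : E d →L[ℝ] E d) :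
    diffOp N a (expIntegral B c) = expIntegral B fun η => symbol N a (B η) * c η := by
  funext y
  have h1 : ∀ β ∈ multiIndices d N, Integrable fun η =>
      Complex.exp (2 * Real.pi * Complex.I * (inner ℝ (B η) y : ℝ)) *
        (a β * (freqMonomial β (B η) * c η)) := fun β hβ => by
    refine ((funDeriv_expIntegral (sum_le_of_mem_multiIndices hβ) h B).2.const_mul _).bdd_mul
      (c := 1) (Continuous.aestronglyMeasurable (by fun_prop)) (Eventually.of_forall fun η => ?_)
    rw [norm_exp_two_pi_I_mul]
  have h2 : ∀ η, Complex.exp (2 * Real.pi * Complex.I * (inner ℝ (B η) y : ℝ)) *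
      (symbol N a (B η) * c η) = ∑ β ∈ multiIndices d N,
        Complex.exp (2 * Real.pi * Complex.I * (inner ℝ (B η) y : ℝ)) *
        (a β * (freqMonomial β (B η) * c η)) := fun η => by
    simp only [symbol, Finset.sum_mul, Finset.mul_sum, mul_assoc]
  rw [expIntegral]
  simp only [h2]
  rw [integral_finsetSum _ h1, diffOp]
  refine Finset.sum_congr rfl fun β hβ => ?_
  rw [(funDeriv_expIntegral (sum_le_of_mem_multiIndices hβ) h B).1, expIntegral,
    ← integral_const_mul]
  refine integral_congr_ae (Eventually.of_forall fun η => ?_)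
  ring

lemma HasMoments.contDiff_fourierInv {N : ℕ} {c : E d → ℂ} (h : HasMoments N c) :
    ContDiff ℝ N (𝓕⁻ c) := by
  have h1 : 𝓕⁻ c = expIntegral (ContinuousLinearMap.id ℝ (E d)) c := by
    funext x
    rw [fourierInv_eq_expIntegral]
    rfl
  rw [h1, expIntegral_eq_fourierIntegral]
  exact VectorFourier.contDiff_fourierIntegral (N := (N : ℕ∞)) _
    fun n hn => h.2 n (by exact_mod_cast hn)

/-- Intermediate moments follow from ‖η‖^m ≤ 1 + ‖η‖^N. -/
lemma hasMoments_of_integrable {N : ℕ} {c : E d → ℂ} (hc : Integrable c)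
    (h : Integrable fun η => ‖η‖ ^ N * ‖c η‖) : HasMoments N c := by
  refine ⟨hc.aestronglyMeasurable, fun m hm => ?_⟩
  refine (hc.norm.add h).mono' ((Continuous.aestronglyMeasurable (by fun_prop)).mul
    hc.aestronglyMeasurable.norm) (Eventually.of_forall fun η => ?_)
  rw [norm_mul, norm_norm, norm_pow, norm_norm]
  have : ‖η‖ ^ m ≤ 1 + ‖η‖ ^ N := by
    rcases le_total ‖η‖ 1 with h1 | h1
    · exact (pow_le_one₀ (norm_nonneg _) h1).trans (by simp)
    · exact (pow_le_pow_right₀ h1 hm).trans (by simp)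
  calc ‖η‖ ^ m * ‖c η‖ ≤ (1 + ‖η‖ ^ N) * ‖c η‖ := by gcongr
    _ = _ := by simp only [Pi.add_apply]; ring

/-! ### Matrices as operators -/

lemma op_transpose (A : Matrix (Fin d) (Fin d) ℝ) :
    op A.transpose = ContinuousLinearMap.adjoint (op A) := by
  have := map_star (Matrix.toEuclideanCLM (n := Fin d) (𝕜 := ℝ)) A
  rw [Matrix.star_eq_conjTranspose, Matrix.conjTranspose_eq_transpose_of_trivial] at this
  exact this

lemma op_mul (A A' : Matrix (Fin d) (Fin d) ℝ) : op (A * A') = op A * op A' :=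
  map_mul (Matrix.toEuclideanCLM (n := Fin d) (𝕜 := ℝ)) A A'

lemma op_one : op (1 : Matrix (Fin d) (Fin d) ℝ) = 1 :=
  map_one (Matrix.toEuclideanCLM (n := Fin d) (𝕜 := ℝ))

lemma adjPow_eq_adjoint (M : Matrix (Fin d) (Fin d) ℝ) (j : ℤ) :
    adjPow M j = ContinuousLinearMap.adjoint (op (M ^ j)) := by
  rw [adjPow, ← Matrix.transpose_zpow, op_transpose]

/-- A dilation of the argument passes to the frequency as the adjoint: (η, M^j y) = (M^{*j}η, y). -/
lemma fourierInv_comp_op (M : Matrix (Fin d) (Fin d) ℝ) (j : ℤ) (c : E d → ℂ) :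
    (fun y => 𝓕⁻ c (op (M ^ j) y)) = expIntegral (adjPow M j) c := by
  funext y
  rw [fourierInv_eq_expIntegral, expIntegral]
  simp only [adjPow_eq_adjoint, ContinuousLinearMap.adjoint_inner_left]

lemma IsDilation.isUnit_det {M : Matrix (Fin d) (Fin d) ℝ} (hM : IsDilation M) :
    IsUnit M.det := by
  by_contra h
  have h0 : M.det = 0 := by simpa using h
  have : (0 : ℂ) ∈ eigenvalues M := by
    rw [eigenvalues, spectrum.zero_mem_iff, Matrix.isUnit_iff_isUnit_det]
    have : (M.map (fun t : ℝ => (t : ℂ))).det = ((M.det : ℝ) : ℂ) :=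
      (RingHom.map_det Complex.ofRealHom M).symm
    rw [this, h0]
    simp
  have := hM 0 this
  simp at this
  linarith

lemma op_zpow_mul_op_zpow_neg {M : Matrix (Fin d) (Fin d) ℝ} (hM : IsUnit M.det) (j : ℤ)
    (x : E d) : op (M ^ (-j)) (op (M ^ j) x) = x := by
  have := op_mul (M ^ (-j)) (M ^ j)
  rw [← Matrix.zpow_add hM, neg_add_cancel, zpow_zero, op_one] at this
  exact (DFunLike.congr_fun this x).symm

/-- An invertible linear map scales Lebesgue measure by a constant. Used to pull a.e. statements
about ζ back along ζ = Bη. -/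
lemma quasiMeasurePreserving_adjPow {M : Matrix (Fin d) (Fin d) ℝ} (hM : IsUnit M.det) (j : ℤ) :
    Measure.QuasiMeasurePreserving (adjPow M j) volume volume := by
  refine ⟨(adjPow M j).continuous.measurable, ?_⟩
  have hdet : LinearMap.det ((adjPow M j : E d →L[ℝ] E d) : E d →ₗ[ℝ] E d) ≠ 0 := by
    have h1 : adjPow M j * adjPow M (-j) = 1 := by
      have hM' : IsUnit M.transpose.det := by rwa [Matrix.det_transpose]
      rw [adjPow, adjPow, ← op_mul, ← Matrix.zpow_add hM', add_neg_cancel, zpow_zero, op_one]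
    have h2 : ((adjPow M j : E d →L[ℝ] E d) : E d →ₗ[ℝ] E d) * (adjPow M (-j) : E d →ₗ[ℝ] E d) =
        1 := by
      ext1 x
      exact DFunLike.congr_fun h1 x
    intro h
    have := congrArg LinearMap.det h2
    rw [map_mul, h, zero_mul, map_one] at this
    exact zero_ne_one this
  have := Measure.map_linearMap_addHaar_eq_smul_addHaar (volume : Measure (E d)) hdet
  have h3 : Measure.map (adjPow M j) (volume : Measure (E d)) = _ := this
  rw [h3]
  exact Measure.smul_absolutelyContinuous

/-! ### Fourier coefficients and partial sums of the modulated θ. -/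

lemma integral_comp_toLp (f : E d → ℂ) :
    ∫ x : Fin d → ℝ, f (WithLp.toLp 2 x) = ∫ ξ, f ξ :=
  (PiLp.volume_preserving_toLp (Fin d)).integral_comp
    (MeasurableEquiv.toLp 2 (Fin d → ℝ)).measurableEmbedding f

lemma toLp_add_castVec (x : Fin d → ℝ) (l : Fin d → ℤ) :
    WithLp.toLp 2 (x + castVec l) = WithLp.toLp 2 x + intVec l := rfl

lemma intChar_eq_exp (k : Fin d → ℤ) (x : Fin d → ℝ) :
    intChar k x =
      Complex.exp (2 * Real.pi * Complex.I * (inner ℝ (WithLp.toLp 2 x) (intVec k) : ℝ)) := by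
  rw [intChar]
  congr 2
  simp [intVec, PiLp.inner_apply]

lemma intChar_neg_eq_exp (k : Fin d → ℤ) (ξ : E d) :
    intChar (-k) ξ.ofLp =
      Complex.exp (2 * Real.pi * Complex.I * (inner ℝ ξ (-intVec k) : ℝ)) := by
  rw [intChar_eq_exp]
  congr 4
  ext i
  simp [intVec]

/-- The function `x ↦ θ(x) e^{2πi(x,y)}`. -/
noncomputable def modulate (θ : E d → ℂ) (y : E d) (x : Fin d → ℝ) : ℂ :=
  Complex.exp (2 * Real.pi * Complex.I * (inner ℝ (WithLp.toLp 2 x) y : ℝ)) *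
    θ (WithLp.toLp 2 x)

lemma norm_modulate (θ : E d → ℂ) (y : E d) (x : Fin d → ℝ) :
    ‖modulate θ y x‖ = ‖θ (WithLp.toLp 2 x)‖ := by
  rw [modulate, norm_mul, norm_exp_two_pi_I_mul, one_mul]

/-- The two exponentials merge, so the values of φ on a shifted lattice become the Fourier
coefficients of a periodization. -/
lemma integral_intChar_mul_modulate (θ : E d → ℂ) (y : E d) (k : Fin d → ℤ) :
    ∫ x, intChar k x * modulate θ y x = 𝓕⁻ θ (y + intVec k) := by
  rw [fourierInv_eq_expIntegral, ← integral_comp_toLp]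
  refine integral_congr_ae (Eventually.of_forall fun x => ?_)
  beta_reduce
  rw [modulate, intChar_eq_exp, ← mul_assoc, ← Complex.exp_add, inner_add_right]
  congr 2
  push_cast
  ring

section Box

variable {a b : Fin d → ℝ} {θ : E d → ℂ}

lemma toLp_mem_box {x : Fin d → ℝ} : WithLp.toLp 2 x ∈ box a b ↔ x ∈ Icc a b := by
  simp only [box, mem_ofPred_eq, mem_Icc, Pi.le_def, forall_and]

lemma modulate_eq_zero (hsupp : ∀ ξ, ξ ∉ box a b → θ ξ = 0) (y : E d) {x : Fin d → ℝ}
    (hx : x ∉ Icc a b) : modulate θ y x = 0 := by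
  rw [modulate, hsupp _ (mt toLp_mem_box.1 hx), mul_zero]

lemma contDiffOn_modulate (hθ : ContDiffOn ℝ (d : ℕ) θ (box a b)) (y : E d) :
    ContDiffOn ℝ d (modulate θ y) (Icc a b) := by
  have hL : ContDiff ℝ d (fun x : Fin d → ℝ => (WithLp.toLp 2 x : E d)) :=
    (EuclideanSpace.equiv (Fin d) ℝ).symm.contDiff
  refine ContDiffOn.mul (ContDiff.contDiffOn ?_) (hθ.comp hL.contDiffOn fun x hx =>
    toLp_mem_box.2 hx)
  refine ContDiff.cexp (contDiff_const.mul (Complex.ofRealCLM.contDiff.comp ?_))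
  exact hL.inner ℝ contDiff_const

lemma measurable_modulate (hsupp : ∀ ξ, ξ ∉ box a b → θ ξ = 0)
    (hθ : ContDiffOn ℝ (d : ℕ) θ (box a b)) (y : E d) : Measurable (modulate θ y) := by
  classical
  have h1 : modulate θ y = (Icc a b).piecewise (modulate θ y) 0 := by
    funext x
    by_cases hx : x ∈ Icc a b
    · simp [hx]
    · simp [hx, modulate_eq_zero hsupp y hx]
  rw [h1]
  exact (contDiffOn_modulate hθ y).continuousOn.measurable_piecewise continuousOn_const
    measurableSet_Icc

lemma exists_norm_le_of_box (hsupp : ∀ ξ, ξ ∉ box a b → θ ξ = 0)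
    (hθ : ContDiffOn ℝ (d : ℕ) θ (box a b)) : ∃ D, ∀ ξ, ‖θ ξ‖ ≤ D := by
  obtain ⟨D, hD⟩ := isCompact_Icc.exists_bound_of_continuousOn
    (contDiffOn_modulate hθ 0).continuousOn
  refine ⟨max D 0, fun ξ => ?_⟩
  by_cases hξ : ξ ∈ box a b
  · have := hD ξ.ofLp (toLp_mem_box.1 hξ)
    rw [norm_modulate] at this
    exact this.trans (le_max_left _ _)
  · rw [hsupp ξ hξ, norm_zero]
    exact le_max_right _ _

lemma integrable_modulate (hsupp : ∀ ξ, ξ ∉ box a b → θ ξ = 0)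
    (hθ : ContDiffOn ℝ (d : ℕ) θ (box a b)) (y : E d) : Integrable (modulate θ y) :=
  (integrableOn_iff_integrable_of_support_subset
    (fun _ hx => by_contra fun h => hx (modulate_eq_zero hsupp y h))).1
    ((contDiffOn_modulate hθ y).continuousOn.integrableOn_compact isCompact_Icc)

lemma integrable_of_box (hsupp : ∀ ξ, ξ ∉ box a b → θ ξ = 0)
    (hθ : ContDiffOn ℝ (d : ℕ) θ (box a b)) : Integrable θ := by
  have h1 := integrable_modulate hsupp hθ 0
  have h2 : modulate θ 0 = θ ∘ WithLp.toLp 2 := by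
    funext x
    simp [modulate]
  rw [h2] at h1
  exact ((PiLp.volume_preserving_toLp (Fin d)).integrable_comp_emb
    (MeasurableEquiv.toLp 2 (Fin d → ℝ)).measurableEmbedding).1 h1

/-- Summing over a cube, a product index set, makes the kernel factor over the coordinates. -/
lemma sum_intChar_mul_intChar_neg (K : ℕ) (x s : Fin d → ℝ) :
    ∑ k ∈ Fintype.piFinset (fun _ : Fin d => Finset.Icc (-(K : ℤ)) (K : ℤ)),
      intChar k x * intChar (-k) s = ∏ i, dirichlet K (x i - s i) := by
  simp only [dirichlet]
  rw [Finset.prod_univ_sum]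
  refine Finset.sum_congr rfl fun k _ => ?_
  rw [intChar, intChar, ← Complex.exp_add, ← Complex.exp_sum]
  congr 1
  simp only [Finset.mul_sum, ← Finset.sum_add_distrib]
  refine Finset.sum_congr rfl fun i _ => ?_
  simp only [Pi.neg_apply]
  push_cast
  ring

lemma cubicFourierSum_eq_integral {g : (Fin d → ℝ) → ℂ} (hg : Integrable g) (K : ℕ)
    (s : Fin d → ℝ) :
    cubicFourierSum g K s = ∫ x, g x * ∏ i, dirichlet K (x i - s i) := by
  simp only [cubicFourierSum, ← sum_intChar_mul_intChar_neg, Finset.mul_sum]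
  rw [integral_finsetSum]
  · refine Finset.sum_congr rfl fun k _ => ?_
    rw [← integral_mul_const]
    refine integral_congr_ae (Eventually.of_forall fun x => ?_)
    ring
  · intro k _
    refine hg.mul_bdd (c := 1) (((continuous_intChar k).mul continuous_const).aestronglyMeasurable)
      (Eventually.of_forall fun x => ?_)
    rw [norm_mul, norm_intChar, norm_intChar, one_mul]

lemma exists_norm_cubicFourierSum_modulate_le (hab : ∀ i, a i < b i)
    (hsupp : ∀ ξ, ξ ∉ box a b → θ ξ = 0) (hθ : ContDiffOn ℝ (d : ℕ) θ (box a b)) (y : E d) :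
    ∃ C, ∀ K s, ‖cubicFourierSum (modulate θ y) K s‖ ≤ C := by
  obtain ⟨C, hC⟩ := exists_norm_setIntegral_Icc_mul_prod_dirichlet_le hab
    (contDiffOn_modulate hθ y)
  refine ⟨C, fun K s => ?_⟩
  rw [cubicFourierSum_eq_integral (integrable_modulate hsupp hθ y),
    ← setIntegral_eq_integral_of_forall_compl_eq_zero (s := Icc a b)]
  · exact hC K s
  · intro x hx
    rw [modulate_eq_zero hsupp y hx, zero_mul]

end Box

/-! ### The error estimate. -/

/-- The cubic partial sums of the expansion are integrals against partial Fourier sums. -/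
lemma cubicSum_eq_integral {M : Matrix (Fin d) (Fin d) ℝ} {N : ℕ} {fhat : E d → ℂ}
    (hfhat : HasMoments N fhat) (a : (Fin d → ℕ) → ℂ) (θ : E d → ℂ) (j : ℤ) (x : E d) (K : ℕ) :
    cubicSum M N a (𝓕⁻ θ) (𝓕⁻ fhat) j x K =
      ((|M.det| ^ ((j : ℝ) / 2) : ℝ) : ℂ) *
        ∫ η, symbol N a (adjPow M (-j) η) * fhat η *
          cubicFourierSum (modulate θ (op (M ^ j) x)) K (adjPow M (-j) η).ofLp := by
  rw [cubicSum, fourierInv_comp_op, hfhat.diffOp_expIntegral a]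
  simp only [cubicFourierSum, integral_intChar_mul_modulate, Finset.mul_sum]
  rw [integral_finsetSum, Finset.mul_sum]
  · refine Finset.sum_congr rfl fun k _ => ?_
    rw [dilShift, expIntegral, mul_comm (∫ _, _), mul_assoc, ← integral_const_mul]
    congr 1
    refine integral_congr_ae (Eventually.of_forall fun η => ?_)
    beta_reduce
    rw [intChar_neg_eq_exp]
    ring
  · intro k _
    refine (hfhat.integrable_symbol_mul a (adjPow M (-j))).mul_bdd
      (c := ‖𝓕⁻ θ (op (M ^ j) x + intVec k)‖) ?_ (Eventually.of_forall fun η => ?_)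
    · refine (continuous_const.mul ((continuous_intChar (-k)).comp ?_)).aestronglyMeasurable
      exact (PiLp.continuous_ofLp 2 _).comp (adjPow M (-j)).continuous
    · rw [norm_mul, norm_intChar, mul_one]

/-- Dividing by δ makes 2π‖ζ‖/δ at least 1, so monomials of every degree up to N are dominated by
its N-th power. -/
lemma norm_symbol_le (N : ℕ) (a : (Fin d → ℕ) → ℂ) {δ : ℝ} (hδ : 0 < δ) (hδ1 : δ ≤ 1) {ζ : E d}
    (hζ : δ ≤ ‖ζ‖) :
    ‖symbol N a ζ‖ ≤ (∑ β ∈ multiIndices d N, ‖a β‖) * (2 * Real.pi) ^ N * (‖ζ‖ / δ) ^ N := by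
  have hpi : 1 ≤ 2 * Real.pi := by linarith [Real.pi_gt_three]
  have h1 : 1 ≤ ‖ζ‖ / δ := (one_le_div hδ).2 hζ
  rw [symbol, Finset.sum_mul, Finset.sum_mul]
  refine (norm_sum_le _ _).trans (Finset.sum_le_sum fun β hβ => ?_)
  rw [norm_mul, mul_assoc]
  refine mul_le_mul_of_nonneg_left ?_ (norm_nonneg _)
  have h2 : 1 ≤ 2 * Real.pi * (‖ζ‖ / δ) := one_le_mul_of_one_le_of_one_le hpi h1
  rw [freqMonomial, norm_prod, ← mul_pow]
  refine le_trans ?_ (pow_le_pow_right₀ h2 (sum_le_of_mem_multiIndices hβ))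
  rw [← Finset.prod_pow_eq_pow_sum]
  refine Finset.prod_le_prod (fun _ _ => norm_nonneg _) fun i _ => ?_
  rw [norm_pow]
  refine pow_le_pow_left₀ (norm_nonneg _) ?_ _
  rw [norm_mul, norm_mul, norm_mul, Complex.norm_I, mul_one, Complex.norm_real, Complex.norm_real,
    Complex.norm_ofNat, Real.norm_of_nonneg Real.pi_pos.le]
  refine mul_le_mul_of_nonneg_left ?_ (by positivity)
  exact (PiLp.norm_apply_le ζ i).trans (le_div_self (norm_nonneg _) hδ hδ1)

/-- Away from the origin cancellation is not needed: the exponential has modulus 1 ≤ (‖ζ‖/δ)^N, and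
the product is bounded factor by factor. -/
lemma norm_sub_symbol_mul_periodize_le (N : ℕ) (a : (Fin d → ℕ) → ℂ) {δ : ℝ} (hδ : 0 < δ)
    (hδ1 : δ ≤ 1) {θ : E d → ℂ} {R : ℝ} (y : E d)
    (hR : ∀ s, ‖periodize (modulate θ y) s‖ ≤ R) {ζ : E d} (hζ : δ ≤ ‖ζ‖) :
    ‖Complex.exp (2 * Real.pi * Complex.I * (inner ℝ ζ y : ℝ)) -
        symbol N a ζ * periodize (modulate θ y) ζ.ofLp‖ ≤
      (1 + (∑ β ∈ multiIndices d N, ‖a β‖) * (2 * Real.pi) ^ N * R) / δ ^ N * ‖ζ‖ ^ N := by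
  have h1 : 1 ≤ (‖ζ‖ / δ) ^ N := one_le_pow₀ ((one_le_div hδ).2 hζ)
  have hR0 : 0 ≤ R := (norm_nonneg _).trans (hR 0)
  calc _ ≤ 1 + ‖symbol N a ζ‖ * ‖periodize (modulate θ y) ζ.ofLp‖ := by
        refine (norm_sub_le _ _).trans_eq ?_
        rw [norm_exp_two_pi_I_mul, norm_mul]
    _ ≤ (‖ζ‖ / δ) ^ N +
        (∑ β ∈ multiIndices d N, ‖a β‖) * (2 * Real.pi) ^ N * (‖ζ‖ / δ) ^ N * R :=
        add_le_add h1 (mul_le_mul (norm_symbol_le N a hδ hδ1 hζ) (hR _) (norm_nonneg _)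
          (by positivity))
    _ = _ := by rw [div_pow]; ring

/-- With v = θ and u the conjugate symbol a.e., conjugating the first condition gives the product
identity. The second is translated by l, and countability of ℤ^d gives one null set for all l. -/
lemma StrictlyCompatibleWith.ae_mul_symbol {N : ℕ} {a : (Fin d → ℕ) → ℂ} {δ : ℝ} {θ : E d → ℂ}
    (h : StrictlyCompatibleWith δ (assocDist N a) (𝓕⁻ θ)) (hθ : Integrable θ) :
    (∀ᵐ ζ : E d, ‖ζ‖ < δ → θ ζ * symbol N a ζ = 1) ∧
      ∀ᵐ ζ : E d, ∀ l : Fin d → ℤ, l ≠ 0 → ‖ζ‖ < δ → θ (ζ + intVec l) = 0 := by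
  obtain ⟨u, v, hu, hv, h1, h2⟩ := h
  have hv' := hv.ae_eq_of_fourierInv hθ
  constructor
  · filter_upwards [hu.ae_eq_conj_symbol, hv', h1] with ζ e1 e2 e3 hζ
    have := e3 hζ
    rw [e1, e2, ← map_mul] at this
    have h3 := congrArg conj this
    rwa [Complex.conj_conj, map_one] at h3
  · rw [ae_all_iff]
    intro l
    by_cases hl : l = 0
    · simp [hl]
    have hq := (measurePreserving_add_right (volume : Measure (E d))
      (intVec l)).quasiMeasurePreserving
    filter_upwards [hq.ae (h2 l hl), hq.ae hv'] with ζ e1 e2 _ hζ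
    rw [← e2]
    refine e1 ?_
    rwa [sub_add_cancel_right, norm_neg]

lemma periodize_modulate_eq {θ : E d → ℂ} (y : E d) {ζ : E d}
    (h : ∀ l : Fin d → ℤ, l ≠ 0 → θ (ζ + intVec l) = 0) :
    periodize (modulate θ y) ζ.ofLp =
      Complex.exp (2 * Real.pi * Complex.I * (inner ℝ ζ y : ℝ)) * θ ζ := by
  rw [periodize, tsum_eq_single 0]
  · have : ζ.ofLp + castVec 0 = ζ.ofLp := by
      funext i; simp [castVec]
    rw [this]
    rfl
  · intro l hl
    rw [modulate, toLp_add_castVec, WithLp.toLp_ofLp, h l hl, mul_zero]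

/-- The error estimate for the expansion. -/
lemma exists_tendsto_cubicSum {M : Matrix (Fin d) (Fin d) ℝ} (hM : IsUnit M.det) {N : ℕ}
    {a : (Fin d → ℕ) → ℂ} {δ : ℝ} (hδ : 0 < δ) (hδ1 : δ ≤ 1) {p q : Fin d → ℝ} {θ : E d → ℂ}
    (hpq : ∀ i, p i < q i) (hsupp : ∀ ξ, ξ ∉ box p q → θ ξ = 0)
    (hθ : ContDiffOn ℝ (d : ℕ) θ (box p q))
    (hcompat : StrictlyCompatibleWith δ (assocDist N a) (𝓕⁻ θ)) :
    ∃ C, 0 ≤ C ∧ ∀ fhat : E d → ℂ, HasMoments N fhat → ∀ (x : E d) (j : ℤ), ∃ s : ℂ,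
        Tendsto (fun K : ℕ => cubicSum M N a (𝓕⁻ θ) (𝓕⁻ fhat) j x K) atTop (𝓝 s) ∧
        ‖𝓕⁻ fhat x - ((|M.det| ^ (-(j : ℝ) / 2) : ℝ) : ℂ) * s‖ ≤ C * tailBound M N δ fhat j := by
  obtain ⟨D, hD⟩ := exists_norm_le_of_box hsupp hθ
  -- Modulation does not change absolute values, so R, and with it C, is independent of y, that is,
  -- of x and j.
  have hmod : ∀ (y : E d) x, ‖modulate θ y x‖ ≤ D := fun y x => by
    rw [norm_modulate]; exact hD _
  set R : ℝ := (∏ i, (|q i - p i| + 1)) * D with hRdef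
  have hR : ∀ (y : E d) s, ‖periodize (modulate θ y) s‖ ≤ R := fun y s =>
    exists_norm_periodize_le (fun x hx => modulate_eq_zero hsupp y hx) (hmod y) s
  have hR0 : 0 ≤ R := (norm_nonneg _).trans (hR 0 0)
  set C : ℝ := (1 + (∑ β ∈ multiIndices d N, ‖a β‖) * (2 * Real.pi) ^ N * R) / δ ^ N with hC
  refine ⟨C, by positivity, fun fhat hfhat x j => ?_⟩
  set y := op (M ^ j) x with hy
  set B := adjPow M (-j) with hB
  have hBq : Measure.QuasiMeasurePreserving B volume volume := quasiMeasurePreserving_adjPow hM (-j)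
  have hp : Measure.QuasiMeasurePreserving (fun η => (B η).ofLp) volume volume :=
    (PiLp.volume_preserving_ofLp (Fin d)).quasiMeasurePreserving.comp hBq
  have hF := hfhat.integrable_symbol_mul a B
  -- This bound may depend on y; it serves only as a dominating constant and does not enter C.
  obtain ⟨C₁, hC₁⟩ := exists_norm_cubicFourierSum_modulate_le hpq hsupp hθ y
  have hlim := tendsto_integral_mul_cubicFourierSum hF hp (measurable_modulate hsupp hθ y)
    (fun x hx => modulate_eq_zero hsupp y hx) (hmod y) hC₁
  refine ⟨_, (hlim.const_mul ((|M.det| ^ ((j : ℝ) / 2) : ℝ) : ℂ)).congr fun K =>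
    (cubicSum_eq_integral hfhat a θ j x K).symm, ?_⟩
  have hm : (0 : ℝ) < |M.det| := abs_pos.2 hM.ne_zero
  have hone : ((|M.det| ^ (-(j : ℝ) / 2) : ℝ) : ℂ) * ((|M.det| ^ ((j : ℝ) / 2) : ℝ) : ℂ) = 1 := by
    rw [← Complex.ofReal_mul, ← Real.rpow_add hm, neg_div, neg_add_cancel, Real.rpow_zero,
      Complex.ofReal_one]
  rw [← mul_assoc, hone, one_mul]
  have hfx : 𝓕⁻ fhat x =
      ∫ η, Complex.exp (2 * Real.pi * Complex.I * (inner ℝ (B η) y : ℝ)) * fhat η := by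
    have := congrFun (fourierInv_comp_op M (-j) fhat) y
    rw [hy, op_zpow_mul_op_zpow_neg hM] at this
    exact this
  have hi1 : Integrable fun η =>
      Complex.exp (2 * Real.pi * Complex.I * (inner ℝ (B η) y : ℝ)) * fhat η :=
    hfhat.integrable.bdd_mul (c := 1) (Continuous.aestronglyMeasurable (by fun_prop))
      (Eventually.of_forall fun η => (norm_exp_two_pi_I_mul _).le)
  have hi2 : Integrable fun η =>
      symbol N a (B η) * fhat η * periodize (modulate θ y) (B η).ofLp :=
    hF.mul_bdd (c := R) ((measurable_periodize (measurable_modulate hsupp hθ y)).comp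
      hp.measurable).aestronglyMeasurable (Eventually.of_forall fun η => hR y _)
  rw [hfx, ← integral_sub hi1 hi2]
  have hset : MeasurableSet {η : E d | δ ≤ ‖B η‖} :=
    measurableSet_le measurable_const B.continuous.norm.measurable
  have hdom : Integrable ({η : E d | δ ≤ ‖B η‖}.indicator
      fun η => C * ‖B‖ ^ N * (‖η‖ ^ N * ‖fhat η‖)) :=
    ((hfhat.2 N le_rfl).const_mul _).indicator hset
  obtain ⟨ha1, ha2⟩ := hcompat.ae_mul_symbol (integrable_of_box hsupp hθ)
  refine (norm_integral_le_of_norm_le hdom ?_).trans_eq ?_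
  · filter_upwards [hBq.ae ha1, hBq.ae ha2] with η e1 e2
    have hfac : Complex.exp (2 * Real.pi * Complex.I * (inner ℝ (B η) y : ℝ)) * fhat η -
        symbol N a (B η) * fhat η * periodize (modulate θ y) (B η).ofLp =
        (Complex.exp (2 * Real.pi * Complex.I * (inner ℝ (B η) y : ℝ)) -
          symbol N a (B η) * periodize (modulate θ y) (B η).ofLp) * fhat η := by ring
    rw [hfac, norm_mul]
    by_cases hη : δ ≤ ‖B η‖
    · rw [indicator_of_mem (by exact hη)]
      calc _ ≤ C * ‖B η‖ ^ N * ‖fhat η‖ := mul_le_mul_of_nonneg_right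
            (norm_sub_symbol_mul_periodize_le N a hδ hδ1 y (hR y) hη) (norm_nonneg _)
        _ ≤ C * (‖B‖ * ‖η‖) ^ N * ‖fhat η‖ := by
            gcongr
            exact B.le_opNorm η
        _ = _ := by rw [mul_pow]; ring
    · rw [indicator_of_notMem (by exact hη)]
      have hη' := not_le.1 hη
      -- Near the origin all shifted copies of θ vanish and θ · symbol = 1, so the integrand is
      -- zero.
      rw [periodize_modulate_eq y fun l hl => e2 l hl hη']
      have : Complex.exp (2 * Real.pi * Complex.I * (inner ℝ (B η) y : ℝ)) - symbol N a (B η) *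
          (Complex.exp (2 * Real.pi * Complex.I * (inner ℝ (B η) y : ℝ)) * θ (B η)) = 0 := by
        linear_combination
          -Complex.exp (2 * Real.pi * Complex.I * (inner ℝ (B η) y : ℝ)) * e1 hη'
      rw [this, norm_zero, zero_mul]
  · rw [integral_indicator hset, integral_const_mul, tailBound, mul_assoc]

/-! ### Norms of the powers of the inverse matrix. -/

/-- The operator on `ℂ^d` given by a real matrix. -/
noncomputable def complexOp (A : Matrix (Fin d) (Fin d) ℝ) :
    EuclideanSpace ℂ (Fin d) →L[ℂ] EuclideanSpace ℂ (Fin d) :=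
  Matrix.toEuclideanCLM (n := Fin d) (𝕜 := ℂ) (A.map (fun t : ℝ => (t : ℂ)))

lemma complexOp_pow (A : Matrix (Fin d) (Fin d) ℝ) (n : ℕ) :
    complexOp (A ^ n) = complexOp A ^ n := by
  rw [complexOp, complexOp, ← map_pow]
  congr 1
  exact map_pow (RingHom.mapMatrix (m := Fin d) Complex.ofRealHom) A n

/-- The inclusion of ℝ^d in ℂ^d is isometric and intertwines the two operators. It transfers bounds
from ℂ, where Gelfand's formula applies. -/
lemma norm_op_le_norm_complexOp (A : Matrix (Fin d) (Fin d) ℝ) : ‖op A‖ ≤ ‖complexOp A‖ := by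
  refine ContinuousLinearMap.opNorm_le_bound _ (norm_nonneg _) fun x => ?_
  set emb : E d → EuclideanSpace ℂ (Fin d) := fun x => WithLp.toLp 2 fun i => (x i : ℂ)
  have h1 : ∀ x, ‖emb x‖ = ‖x‖ := fun x => by
    simp [emb, EuclideanSpace.norm_eq]
  have h2 : complexOp A (emb x) = emb (op A x) := by
    ext i
    simp only [complexOp, op, Matrix.ofLp_toEuclideanCLM, emb]
    simp [Matrix.mulVec, dotProduct]
  rw [← h1, ← h1, ← h2]
  exact (complexOp A).le_opNorm _

lemma norm_lt_inv_of_mem_spectrum_inv {M : Matrix (Fin d) (Fin d) ℝ} (hM : IsUnit M.det) {ϑ : ℝ}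
    (hϑ : 0 < ϑ) (h : ∀ z ∈ eigenvalues M, ϑ < ‖z‖) {z : ℂ}
    (hz : z ∈ spectrum ℂ (complexOp M⁻¹)) : ‖z‖ < ϑ⁻¹ := by
  have hmul : ∀ A A' : Matrix (Fin d) (Fin d) ℝ, A * A' = 1 →
      A.map (fun t : ℝ => (t : ℂ)) * A'.map (fun t : ℝ => (t : ℂ)) = 1 := by
    intro A A' hA
    have h1 := map_mul (RingHom.mapMatrix (m := Fin d) Complex.ofRealHom) A A'
    rw [hA, map_one] at h1
    exact h1.symm
  let u : (Matrix (Fin d) (Fin d) ℂ)ˣ :=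
    ⟨M.map (fun t : ℝ => (t : ℂ)), M⁻¹.map (fun t : ℝ => (t : ℂ)),
      hmul _ _ (Matrix.mul_nonsing_inv M hM), hmul _ _ (Matrix.nonsing_inv_mul M hM)⟩
  have h1 : z ∈ spectrum ℂ ((u⁻¹ : (Matrix (Fin d) (Fin d) ℂ)ˣ) : Matrix (Fin d) (Fin d) ℂ) := by
    rw [complexOp, AlgEquiv.spectrum_eq] at hz
    exact hz
  rw [← spectrum.map_inv, Set.mem_inv] at h1
  have h2 := h _ h1
  rw [norm_inv] at h2
  exact (lt_inv_comm₀ hϑ (by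
    by_contra h3
    have : ‖z‖ = 0 := le_antisymm (not_lt.1 h3) (norm_nonneg _)
    rw [this, inv_zero] at h2
    linarith)).1 h2

/-- The spectral radius of the inverse is below ϑ⁻¹, so Gelfand's formula gives ‖A^n‖ ≤ ϑ^{-n} for
large n; the constant absorbs the finitely many other n. -/
lemma exists_norm_adjPow_le (hd : 1 ≤ d) {M : Matrix (Fin d) (Fin d) ℝ} (hM : IsUnit M.det)
    {ϑ : ℝ} (hϑ : 0 < ϑ) (h : ∀ z ∈ eigenvalues M, ϑ < ‖z‖) :
    ∃ c : ℝ, 0 < c ∧ ∀ n : ℕ, ‖adjPow M (-(n : ℤ))‖ ≤ c * (ϑ ^ n)⁻¹ := by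
  -- For d ≥ 1 the operator algebra is nontrivial and the spectrum is nonempty and compact, so a
  -- strict bound on its points passes to the spectral radius.
  have : Nonempty (Fin d) := ⟨⟨0, hd⟩⟩
  set A := complexOp M⁻¹ with hA
  let ρ : NNReal := ⟨ϑ⁻¹, by positivity⟩
  have hrad : spectralRadius ℂ A < ρ :=
    spectrum.spectralRadius_lt_of_forall_lt A fun z hz =>
      norm_lt_inv_of_mem_spectrum_inv hM hϑ h hz
  have hev := (spectrum.pow_nnnorm_pow_one_div_tendsto_nhds_spectralRadius A).eventually_lt_const
    hrad
  obtain ⟨n₀, hn₀⟩ := eventually_atTop.1 (hev.and (eventually_gt_atTop 0))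
  have hlarge : ∀ n ≥ n₀, ‖A ^ n‖ ≤ (ϑ ^ n)⁻¹ := by
    intro n hn
    obtain ⟨h1, h2⟩ := hn₀ n hn
    have h2' : (0 : ℝ) < n := by exact_mod_cast h2
    rw [← ENNReal.coe_rpow_of_nonneg _ (by positivity), ENNReal.coe_lt_coe] at h1
    have h3 : ‖A ^ n‖ ^ (1 / (n : ℝ)) ≤ ϑ⁻¹ := by
      have h5 := NNReal.coe_le_coe.2 h1.le
      rwa [NNReal.coe_rpow, coe_nnnorm] at h5
    have h4 := Real.rpow_le_rpow (by positivity) h3 h2'.le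
    rw [← Real.rpow_mul (norm_nonneg _), one_div_mul_cancel h2'.ne', Real.rpow_one,
      Real.rpow_natCast, inv_pow] at h4
    exact h4
  refine ⟨1 + ∑ n ∈ Finset.range n₀, ‖A ^ n‖ * ϑ ^ n, by positivity, fun n => ?_⟩
  have h1 : ‖adjPow M (-(n : ℤ))‖ ≤ ‖A ^ n‖ := by
    rw [adjPow_eq_adjoint, LinearIsometryEquiv.norm_map, hA, ← complexOp_pow,
      Matrix.zpow_neg_natCast, ← Matrix.inv_pow']
    exact norm_op_le_norm_complexOp _
  refine h1.trans ?_
  have hpos : 0 < ϑ ^ n := pow_pos hϑ n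
  rw [← div_eq_mul_inv, le_div_iff₀ hpos]
  rcases lt_or_ge n n₀ with hn | hn
  · have := Finset.single_le_sum (f := fun n => ‖A ^ n‖ * ϑ ^ n) (fun _ _ => by positivity)
      (Finset.mem_range.2 hn)
    linarith
  · have h2 := mul_le_mul_of_nonneg_right (hlarge n hn) hpos.le
    rw [inv_mul_cancel₀ hpos.ne'] at h2
    have : 0 ≤ ∑ n ∈ Finset.range n₀, ‖A ^ n‖ * ϑ ^ n :=
      Finset.sum_nonneg fun _ _ => by positivity
    linarith

/-! ### Tails of functions with power decay -/

lemma measurableSet_le_norm (R : ℝ) : MeasurableSet {ξ : E d | R ≤ ‖ξ‖} :=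
  measurableSet_le measurable_const measurable_norm

/-- Comparison with the integrable (1 + ‖ξ‖)^{-r}: for R ≤ ‖ξ‖ one has (R/(1 + R))(1 + ‖ξ‖) ≤ ‖ξ‖.
-/
lemma integrableOn_norm_rpow {r R : ℝ} (hr : (d : ℝ) < r) (hR : 0 < R) :
    IntegrableOn (fun ξ : E d => ‖ξ‖ ^ (-r)) {ξ | R ≤ ‖ξ‖} := by
  have hr0 : 0 ≤ r := (Nat.cast_nonneg d).trans hr.le
  have h1 : Integrable (fun ξ : E d => (1 + ‖ξ‖) ^ (-r)) :=
    integrable_one_add_norm (by simpa using hr)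
  refine ((h1.const_mul ((R / (1 + R)) ^ (-r))).integrableOn).mono'
    (Measurable.aestronglyMeasurable (measurable_norm.pow_const (-r))) ((ae_restrict_iff' (measurableSet_le_norm R)).2 (Eventually.of_forall ?_))
  intro ξ hξ
  have hξ : R ≤ ‖ξ‖ := hξ
  rw [Real.norm_of_nonneg (by positivity), ← Real.mul_rpow (by positivity) (by positivity)]
  refine Real.rpow_le_rpow_of_nonpos (by positivity) ?_ (by linarith)
  rw [div_mul_eq_mul_div, div_le_iff₀ (by positivity)]
  nlinarith

open scoped Pointwise in
-- Homogeneity under the substitution ξ ↦ Rξ.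
lemma setIntegral_norm_rpow (r : ℝ) {R : ℝ} (hR : 0 < R) :
    ∫ ξ in {ξ : E d | R ≤ ‖ξ‖}, ‖ξ‖ ^ (-r) =
      R ^ ((d : ℝ) - r) * ∫ ξ in {ξ : E d | 1 ≤ ‖ξ‖}, ‖ξ‖ ^ (-r) := by
  have h := Measure.setIntegral_comp_smul_of_pos (volume : Measure (E d))
    (fun ξ => ‖ξ‖ ^ (-r)) {ξ : E d | 1 ≤ ‖ξ‖} hR
  have hs : R • {ξ : E d | 1 ≤ ‖ξ‖} = {ξ : E d | R ≤ ‖ξ‖} := by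
    ext ξ
    rw [Set.mem_smul_set_iff_inv_smul_mem₀ hR.ne']
    show 1 ≤ ‖R⁻¹ • ξ‖ ↔ R ≤ ‖ξ‖
    rw [norm_smul, norm_inv, Real.norm_of_nonneg hR.le, ← div_eq_inv_mul, one_le_div hR]
  have hm : ∀ ξ : E d, ‖R • ξ‖ ^ (-r) = R ^ (-r) * ‖ξ‖ ^ (-r) := fun ξ => by
    rw [norm_smul, Real.norm_of_nonneg hR.le, Real.mul_rpow hR.le (norm_nonneg _)]
  simp only [hm, hs] at h
  rw [integral_const_mul, finrank_euclideanSpace_fin, smul_eq_mul] at h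
  rw [sub_eq_add_neg, Real.rpow_add hR, Real.rpow_natCast, mul_assoc, h, mul_inv_cancel_left₀]
  positivity

lemma exists_norm_le_of_isBigO {g : E d → ℂ} {r : ℝ}
    (h : g =O[Bornology.cobounded (E d) ⊓ ae volume] fun ξ => ‖ξ‖ ^ (-r)) :
    ∃ c R : ℝ, 0 < c ∧ 0 < R ∧ ∀ᵐ ξ : E d, R ≤ ‖ξ‖ → ‖g ξ‖ ≤ c * ‖ξ‖ ^ (-r) := by
  obtain ⟨c, hc, hb⟩ := h.exists_pos
  rw [Asymptotics.IsBigOWith, Filter.eventually_inf] at hb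
  obtain ⟨s, hs, t, ht, hst⟩ := hb
  obtain ⟨R, -, hR⟩ := (Metric.hasBasis_cobounded_compl_closedBall (0 : E d)).mem_iff.1 hs
  -- The shift by 1 makes the radius positive and puts its exterior strictly outside the closed
  -- ball.
  refine ⟨c, max R 0 + 1, hc, by positivity, ?_⟩
  filter_upwards [ht] with ξ hξ hRξ
  have h1 : ξ ∈ s := hR (by
    rw [mem_compl_iff, mem_closedBall_zero_iff, not_le]
    linarith [le_max_left R 0])
  have := hst ξ ⟨h1, hξ⟩
  rwa [Real.norm_of_nonneg (by positivity)] at this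

lemma norm_pow_mul_le {N : ℕ} {ε c : ℝ} {ξ : E d} {w : ℂ} (hξ : 0 < ‖ξ‖)
    (h : ‖w‖ ≤ c * ‖ξ‖ ^ (-((N : ℝ) + (d : ℝ) + ε))) :
    ‖ξ‖ ^ N * ‖w‖ ≤ c * ‖ξ‖ ^ (-((d : ℝ) + ε)) := by
  calc ‖ξ‖ ^ N * ‖w‖ ≤ ‖ξ‖ ^ N * (c * ‖ξ‖ ^ (-((N : ℝ) + (d : ℝ) + ε))) := by gcongr
    _ = c * (‖ξ‖ ^ (N : ℝ) * ‖ξ‖ ^ (-((N : ℝ) + (d : ℝ) + ε))) := by rw [Real.rpow_natCast]; ring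
    _ = _ := by rw [← Real.rpow_add hξ]; ring_nf

section Decay

variable {N : ℕ} {ε : ℝ} {g : E d → ℂ}

/-- Inside radius R the factor is at most R^N and g is integrable; outside, the product is
O(‖ξ‖^{-(d+ε)}). -/
lemma integrable_norm_pow_mul_of_isBigO (hε : 0 < ε) (hg : Integrable g)
    (h : g =O[Bornology.cobounded (E d) ⊓ ae volume]
      fun ξ => ‖ξ‖ ^ (-((N : ℝ) + (d : ℝ) + ε))) :
    Integrable fun ξ => ‖ξ‖ ^ N * ‖g ξ‖ := by
  obtain ⟨c, R, hc, hR, hb⟩ := exists_norm_le_of_isBigO h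
  have hm : AEStronglyMeasurable (fun ξ => ‖ξ‖ ^ N * ‖g ξ‖) (volume : Measure (E d)) :=
    (Continuous.aestronglyMeasurable (by fun_prop)).mul hg.aestronglyMeasurable.norm
  have h1 : Integrable ({ξ : E d | R ≤ ‖ξ‖}.indicator fun ξ => c * ‖ξ‖ ^ (-((d : ℝ) + ε))) :=
    (integrable_indicator_iff (measurableSet_le_norm R)).2
      ((integrableOn_norm_rpow (by linarith) hR).const_mul c)
  refine ((hg.norm.const_mul (R ^ N)).add h1).mono' hm ?_
  filter_upwards [hb] with ξ hξ
  rw [Real.norm_of_nonneg (by positivity), Pi.add_apply]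
  by_cases hRξ : R ≤ ‖ξ‖
  · rw [indicator_of_mem (by exact hRξ)]
    have := norm_pow_mul_le (hR.trans_le hRξ) (hξ hRξ)
    have h2 : 0 ≤ R ^ N * ‖g ξ‖ := by positivity
    linarith
  · rw [indicator_of_notMem (by exact hRξ), add_zero]
    have := not_le.1 hRξ
    gcongr

/-- Beyond the radius R₀ where the decay holds, this is the scaling of the power tail. For smaller R
the total mass suffices, since (R₀/R)^ε ≥ 1. -/
lemma exists_setIntegral_tail_le (hε : 0 < ε) (hg : Integrable g)
    (h : g =O[Bornology.cobounded (E d) ⊓ ae volume]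
      fun ξ => ‖ξ‖ ^ (-((N : ℝ) + (d : ℝ) + ε))) :
    ∃ C : ℝ, 0 ≤ C ∧ ∀ R : ℝ, 0 < R →
      ∫ ξ in {ξ : E d | R ≤ ‖ξ‖}, ‖ξ‖ ^ N * ‖g ξ‖ ≤ C * R ^ (-ε) := by
  have hint := integrable_norm_pow_mul_of_isBigO hε hg h
  obtain ⟨c, R₀, hc, hR₀, hb⟩ := exists_norm_le_of_isBigO h
  set κ := ∫ ξ in {ξ : E d | 1 ≤ ‖ξ‖}, ‖ξ‖ ^ (-((d : ℝ) + ε)) with hκ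
  have hκ0 : 0 ≤ κ := integral_nonneg fun ξ => by positivity
  set I := ∫ ξ, ‖ξ‖ ^ N * ‖g ξ‖ with hI
  have hI0 : 0 ≤ I := integral_nonneg fun ξ => by positivity
  refine ⟨c * κ + I * R₀ ^ ε, by positivity, fun R hR => ?_⟩
  have hRε : 0 < R ^ (-ε) := by positivity
  rcases le_total R₀ R with hle | hle
  · have h1 : ∫ ξ in {ξ : E d | R ≤ ‖ξ‖}, ‖ξ‖ ^ N * ‖g ξ‖ ≤
        ∫ ξ in {ξ : E d | R ≤ ‖ξ‖}, c * ‖ξ‖ ^ (-((d : ℝ) + ε)) := by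
      refine setIntegral_mono_on_ae hint.integrableOn
        ((integrableOn_norm_rpow (by linarith) hR).const_mul c) (measurableSet_le_norm R) ?_
      filter_upwards [hb] with ξ hξ hRξ
      have hRξ : R ≤ ‖ξ‖ := hRξ
      exact norm_pow_mul_le (hR.trans_le hRξ) (hξ (hle.trans hRξ))
    rw [integral_const_mul, setIntegral_norm_rpow _ hR, ← hκ] at h1
    have h2 : (d : ℝ) - (d + ε) = -ε := by ring
    rw [h2] at h1
    have h3 : 0 ≤ I * R₀ ^ ε * R ^ (-ε) := by positivity
    linarith
  · have h1 : ∫ ξ in {ξ : E d | R ≤ ‖ξ‖}, ‖ξ‖ ^ N * ‖g ξ‖ ≤ I :=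
      setIntegral_le_integral hint (Eventually.of_forall fun ξ => by positivity)
    have h2 : 1 ≤ R₀ ^ ε * R ^ (-ε) := by
      rw [Real.rpow_neg hR.le, ← div_eq_mul_inv, one_le_div (by positivity)]
      exact Real.rpow_le_rpow hR.le hle hε.le
    have h3 : I * 1 ≤ I * (R₀ ^ ε * R ^ (-ε)) := mul_le_mul_of_nonneg_left h2 hI0
    have h4 : 0 ≤ c * κ * R ^ (-ε) := by positivity
    linarith

/-- The tail bound decays like `ϑ^{-j(N + ε)}`. -/
lemma exists_tailBound_le (hd : 1 ≤ d) {M : Matrix (Fin d) (Fin d) ℝ} (hM : IsUnit M.det)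
    {δ : ℝ} (hδ : 0 < δ) (hε : 0 < ε) (hg : Integrable g)
    (h : g =O[Bornology.cobounded (E d) ⊓ ae volume]
      fun ξ => ‖ξ‖ ^ (-((N : ℝ) + (d : ℝ) + ε)))
    {ϑ : ℝ} (hϑ : 0 < ϑ) (hϑM : ∀ z ∈ eigenvalues M, ϑ < ‖z‖) :
    ∃ C' : ℝ, ∀ j : ℤ, 0 ≤ j →
      tailBound M N δ g j ≤ C' * ϑ ^ (-(j : ℝ) * ((N : ℝ) + ε)) := by
  obtain ⟨c, hc, hcB⟩ := exists_norm_adjPow_le hd hM hϑ hϑM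
  obtain ⟨C, hC, hCR⟩ := exists_setIntegral_tail_le hε hg h
  have hint := integrable_norm_pow_mul_of_isBigO hε hg h
  refine ⟨c ^ N * (C * (δ / c) ^ (-ε)), fun j hj => ?_⟩
  lift j to ℕ using hj
  set B := adjPow M (-(j : ℤ)) with hB
  have hpos : 0 < ϑ ^ j := pow_pos hϑ j
  -- From δ ≤ ‖B‖‖ξ‖ ≤ cϑ^{-j}‖ξ‖: the region recedes to infinity at rate ϑ^j.
  have hsub : {ξ : E d | δ ≤ ‖B ξ‖} ⊆ {ξ : E d | δ / c * ϑ ^ j ≤ ‖ξ‖} := by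
    intro ξ hξ
    have hξ : δ ≤ ‖B ξ‖ := hξ
    have h1 : δ ≤ c * (ϑ ^ j)⁻¹ * ‖ξ‖ :=
      hξ.trans ((B.le_opNorm ξ).trans (mul_le_mul_of_nonneg_right (hcB j) (norm_nonneg _)))
    show δ / c * ϑ ^ j ≤ ‖ξ‖
    calc δ / c * ϑ ^ j ≤ (c * (ϑ ^ j)⁻¹ * ‖ξ‖) / c * ϑ ^ j := by gcongr
      _ = ‖ξ‖ := by field_simp
  have h1 : ∫ ξ in {ξ : E d | δ ≤ ‖B ξ‖}, ‖ξ‖ ^ N * ‖g ξ‖ ≤ C * (δ / c * ϑ ^ j) ^ (-ε) :=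
    (setIntegral_mono_set hint.integrableOn (Eventually.of_forall fun ξ => by positivity)
      hsub.eventuallyLE).trans (hCR _ (by positivity))
  have h2 : ‖B‖ ^ N ≤ c ^ N * ((ϑ ^ j)⁻¹) ^ N := by
    rw [← mul_pow]
    exact pow_le_pow_left₀ (norm_nonneg _) (hcB j) N
  -- The factor ϑ^{-jN} comes from ‖B‖^N and ϑ^{-jε} from the tail integral.
  have h3 : ϑ ^ (-((j : ℤ) : ℝ) * ((N : ℝ) + ε)) = ((ϑ ^ j)⁻¹) ^ N * (ϑ ^ j) ^ (-ε) := by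
    rw [mul_add, Real.rpow_add hϑ, Int.cast_natCast, Real.rpow_mul hϑ.le, Real.rpow_natCast,
      Real.rpow_neg hϑ.le, Real.rpow_natCast, neg_mul, ← mul_neg, Real.rpow_mul hϑ.le,
      Real.rpow_natCast]
  rw [h3, tailBound]
  calc _ ≤ c ^ N * ((ϑ ^ j)⁻¹) ^ N * (C * (δ / c * ϑ ^ j) ^ (-ε)) :=
        mul_le_mul h2 h1 (integral_nonneg fun ξ => by positivity) (by positivity)
    _ = _ := by rw [Real.mul_rpow (by positivity) hpos.le]; ring

end Decay

end DiffExpansion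

/-! ### The theorem. -/

open DiffExpansion in
theorem theorem16 {d : ℕ} (hd : 1 ≤ d)
    (M : Matrix (Fin d) (Fin d) ℝ) (hM : IsDilation M)
    (N : ℕ) (a : (Fin d → ℕ) → ℂ) (ha : a 0 ≠ 0)
    (φ : E d → ℂ) (hφ : φ ∈ classB d)
    (δ : ℝ) (hδ : δ ∈ Ioo (0 : ℝ) (1 / 2))
    (hcompat : StrictlyCompatibleWith δ (assocDist N a) φ) :
    ∃ C : ℝ, ∀ (f fhat : E d → ℂ) (ε : ℝ), 0 < ε →
      Continuous f → IsFourierOf fhat f → Integrable fhat →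
      fhat =O[Bornology.cobounded (E d) ⊓ ae volume]
        (fun ξ => ‖ξ‖ ^ (-((N : ℝ) + (d : ℝ) + ε))) →
      ContDiff ℝ N f ∧
      Integrable (fun ξ : E d => ‖ξ‖ ^ N * ‖fhat ξ‖) ∧
      (∀ (x : E d) (j : ℤ), ∃ s : ℂ,
        Tendsto (fun K : ℕ => cubicSum M N a φ f j x K) atTop (𝓝 s) ∧
        ‖f x - ((|M.det| ^ (-(j : ℝ) / 2) : ℝ) : ℂ) * s‖ ≤ C * tailBound M N δ fhat j) ∧
      ∀ ϑ : ℝ, 0 < ϑ → (∀ z ∈ eigenvalues M, ϑ < ‖z‖) →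
        ∃ C' : ℝ, ∀ j : ℤ, 0 ≤ j →
          C * tailBound M N δ fhat j ≤ C' * ϑ ^ (-(j : ℝ) * ((N : ℝ) + ε)) := by
  obtain ⟨p, q, θ, hpq, hsupp, hθ, rfl⟩ := hφ
  have hdet := hM.isUnit_det
  obtain ⟨C, hC, hCf⟩ := exists_tendsto_cubicSum hdet hδ.1 (by linarith [hδ.2]) hpq hsupp hθ hcompat
  refine ⟨C, fun f fhat ε hε hf hfhat hint hO => ?_⟩
  have hpow := integrable_norm_pow_mul_of_isBigO hε hint hO
  have hmom : HasMoments N fhat := hasMoments_of_integrable hint hpow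
  -- Continuity of f makes inversion hold at every point, so f may be replaced by 𝓕⁻ f̂ throughout.
  obtain rfl := hfhat.eq_fourierInv hf hint
  refine ⟨hmom.contDiff_fourierInv, hpow, hCf fhat hmom, fun ϑ hϑ hϑM => ?_⟩
  obtain ⟨C', hC'⟩ := exists_tailBound_le hd hdet hδ.1 hε hint hO hϑ hϑM
  refine ⟨C * C', fun j hj => ?_⟩
  rw [mul_assoc]
  exact mul_le_mul_of_nonneg_left (hC' j hj) hC
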